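/- \textbf{Model.} Let $\Phi=\{X_i\}$ (the nodes) and $\Psi=\{U_j\}$ (the static users) be independent homogeneous Poisson point processes on $\mathbb{R}^2$ with intensities $\lambda>0$ and $\xi>0$. A mobile user starts from the origin at time $0$ and moves along a straight line at constant speed $v>0$. Let $X(t)\in\Phi$ be the node closest to the mobile user at time $t$, $L(t)$ its distance to the mobile user, and $\mathrm{SNR}(t)=p\,L(t)^{-\beta}/w$, where $p,w>0$ and $\beta>2$. Fix a threshold $\gamma>0$ and $a>0$, and for $s>0$ let $r_s=(p/(ws))^{1/\beta}$ be the radius of coverage for the SNR threshold $s$. The Shannon rate is $R(t)=a\log(1+\mathrm{SNR}(t))$ if $L(t)\le r_\gamma$ and $R(t)=0$ otherwise. Let $\hat N(t)$ be the number of static users in the closed disc of radius $r_\gamma$ centered at $X(t)$ if $L(t)\le r_\gamma$, and $\hat N(t)=0$ otherwise. The lower-bound shared-rate process is $\hat S(t)=R(t)/(\hat N(t)+1)$, $t\ge 0$. For $\delta>0$, an up-crossing of level $\delta$ is a time $t>0$ such that, for some $\varepsilon>0$, $\hat S<\delta$ on $(t-\varepsilon,t)$ and $\hat S\ge\delta$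 on $(t,t+\varepsilon)$. Let $\rho_\delta=r_{e^{\delta/a}-1}$ be the radius of coverage associated with the rate level $\delta$, i.e. the distance to the node at which $a\log(1+\mathrm{SNR})=\delta$, and let $f(\rho)=2\lambda v\rho$. \textbf{Corollary.} For every $\delta>0$, almost surely $\hat S$ has infinitely many up-crossings of level $\delta$, finitely many of them in every bounded time interval; let $T_1^{(\delta)}<T_2^{(\delta)}<\cdots$ be their times. For every fixed $n\ge 1$, the inter-arrival time $\hat Z_\delta=T^{(\delta)}_{n+1}-T^{(\delta)}_n$ satisfies $$ f(\rho_\delta)\,e^{-\xi\pi r_\gamma^2}\,\hat Z_\delta \xrightarrow{d} \mathrm{Exp}(1)\qquad\text{as }\delta\to\infty, $$ that is, $\mathbb{P}\big(f(\rho_\delta)e^{-\xi\pi r_\gamma^2}\hat Z_\delta\le x\big)\to \mathbb{P}(E\le x)$ for every $x\in\mathbb{R}$, where $E$ is exponentially distributed with mean $1$. -/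

import Mathlib

open MeasureTheory ProbabilityTheory Filter Topology Set

/-- The Euclidean plane. -/
abbrev Plane : Type := EuclideanSpace ℝ (Fin 2)

/-- The number (possibly infinite) of points of the configuration `x 0, x 1, x 2, …` in `B`. -/
noncomputable def pointCount (x : ℕ → Plane) (B : Set Plane) : ℕ∞ :=
  {i | x i ∈ B}.encard

/-- `X 0, X 1, X 2, …` are the points of a homogeneous Poisson point process on the plane with
the given intensity: the number of points in a Borel set of finite area is Poisson distributed
with mean intensity times area, and the numbers of points in disjoint Borel sets are
independent. -/
structure IsPoissonPointProcess {Ω : Type*} [MeasurableSpace Ω] (P : Measure Ω)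
    (X : ℕ → Ω → Plane) (intensity : ℝ) : Prop where
  measurable_point : ∀ i, Measurable (X i)
  count_law : ∀ B : Set Plane, MeasurableSet B → volume B ≠ ⊤ → ∀ k : ℕ,
    P {ω | pointCount (fun i => X i ω) B = k} =
      ENNReal.ofReal (Real.exp (-(intensity * (volume B).toReal)) *
        (intensity * (volume B).toReal) ^ k / (k.factorial : ℝ))
  count_indep : ∀ (n : ℕ) (B : Fin n → Set Plane), (∀ i, MeasurableSet (B i)) →
    Pairwise (fun i j => Disjoint (B i) (B j)) →
      iIndepFun (fun i ω => pointCount (fun m => X m ω) (B i)) P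

/-- The numerical parameters of the network: intensity `lam` of the nodes, intensity `xi` of the
static users, speed `v` and direction `dir` of the tagged mobile user, transmission power `p`,
noise power `w`, path loss exponent `beta`, bandwidth constant `a` and SNR threshold `gam` under
which no user is served. -/
structure NetworkParams where
  lam : ℝ
  xi : ℝ
  v : ℝ
  dir : Plane
  p : ℝ
  w : ℝ
  beta : ℝ
  a : ℝ
  gam : ℝ

namespace NetworkParams

/-- The standing assumptions on the parameters. -/
structure Admissible (M : NetworkParams) : Prop where
  lam_pos : 0 < M.lam
  xi_pos : 0 < M.xi
  v_pos : 0 < M.v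
  norm_dir : ‖M.dir‖ = 1
  p_pos : 0 < M.p
  w_pos : 0 < M.w
  two_lt_beta : 2 < M.beta
  a_pos : 0 < M.a
  gam_pos : 0 < M.gam

/-- The location of the tagged user at time `t`: it starts from the origin and moves along a
straight line with constant velocity. -/
noncomputable def position (M : NetworkParams) (t : ℝ) : Plane := (M.v * t) • M.dir

/-- The radius of coverage for the SNR threshold `s`: the distance from a node at which the SNR
equals `s`. -/
noncomputable def coverageRadius (M : NetworkParams) (s : ℝ) : ℝ :=
  (M.p / (M.w * s)) ^ (1 / M.beta)

/-- The radius associated with a rate level `δ`: the radius of coverage for the SNR threshold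
`exp (δ / a) - 1`, at which the unshared Shannon rate `a * log (1 + SNR)` equals `δ`. -/
noncomputable def rateRadius (M : NetworkParams) (δ : ℝ) : ℝ :=
  M.coverageRadius (Real.exp (δ / M.a) - 1)

end NetworkParams

/-- The Voronoi cell of the node `nodes i`. -/
def voronoiCell (nodes : ℕ → Plane) (i : ℕ) : Set Plane :=
  {y | ∀ j, dist y (nodes i) ≤ dist y (nodes j)}

/-- The Johnson--Mehl cell of the node `nodes i` with radius `r`. -/
def johnsonMehlCell (nodes : ℕ → Plane) (r : ℝ) (i : ℕ) : Set Plane :=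
  voronoiCell nodes i ∩ Metric.closedBall (nodes i) r

/-- The index of the node closest to `y`, the smallest one in case of a tie (along the path of
the mobile user, ties occur almost surely at isolated instants only). -/
noncomputable def closestIndex (nodes : ℕ → Plane) (y : Plane) : ℕ :=
  sInf {i | y ∈ voronoiCell nodes i}

namespace NetworkParams

/-- `X(t)`: the node closest to the mobile user at time `t`. -/
noncomputable def closestNode (M : NetworkParams) (nodes : ℕ → Plane) (t : ℝ) : Plane :=
  nodes (closestIndex nodes (M.position t))

/-- `L(t)`: the distance from the mobile user to its closest node at time `t`. -/
noncomputable def distClosest (M : NetworkParams) (nodes : ℕ → Plane) (t : ℝ) : ℝ :=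
  dist (M.position t) (M.closestNode nodes t)

/-- The signal-to-noise ratio of the mobile user at time `t`. -/
noncomputable def snr (M : NetworkParams) (nodes : ℕ → Plane) (t : ℝ) : ℝ :=
  M.p * M.distClosest nodes t ^ (-M.beta) / M.w

/-- `R(t)`: the Shannon rate, which is zero if the mobile user is not covered. -/
noncomputable def shannonRate (M : NetworkParams) (nodes : ℕ → Plane) (t : ℝ) : ℝ :=
  if M.distClosest nodes t ≤ M.coverageRadius M.gam then
    M.a * Real.log (1 + M.snr nodes t)
  else 0

open Classical in
/-- The upper bound of the sharing number: the number of static users in the closed disc centered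
at the closest node with the radius of coverage if the mobile user is in the Johnson--Mehl cell
of that node, and zero otherwise. -/
noncomputable def upperSharingNumber (M : NetworkParams) (nodes users : ℕ → Plane) (t : ℝ) : ℕ :=
  if M.position t ∈ johnsonMehlCell nodes (M.coverageRadius M.gam)
      (closestIndex nodes (M.position t)) then
    (pointCount users
      (Metric.closedBall (M.closestNode nodes t) (M.coverageRadius M.gam))).toNat
  else 0

/-- The lower bound of the shared rate. -/
noncomputable def lowerSharedRate (M : NetworkParams) (nodes users : ℕ → Plane) (t : ℝ) : ℝ :=
  M.shannonRate nodes t * (1 / ((M.upperSharingNumber nodes users t : ℝ) + 1))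

end NetworkParams

/-- The set of the times `t > 0` at which the path `S` up-crosses the level `δ`: it is below `δ`
right before `t` and not below `δ` right after `t`. -/
def upCrossingSet (S : ℝ → ℝ) (δ : ℝ) : Set ℝ :=
  {t | 0 < t ∧ ∃ ε > 0, (∀ s ∈ Ioo (t - ε) t, S s < δ) ∧ ∀ s ∈ Ioo t (t + ε), δ ≤ S s}

/-- The time of the `n`-th up-crossing of the level `δ` by the path `S` (for `n = 1, 2, …`). It is
meaningful if there are infinitely many up-crossings, finitely many in every bounded interval. -/
noncomputable def nthUpCrossing (S : ℝ → ℝ) (δ : ℝ) (n : ℕ) : ℝ :=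
  sInf {t | 0 ≤ t ∧ (n : ℕ∞) ≤ (upCrossingSet S δ ∩ Iic t).encard}

/-! Write r for the coverage radius at SNR threshold γ, ρ for the radius of the level δ, and κ =
exp(-ξπr²) for the probability that a disc of radius r contains no user. Off the nodes themselves,
the path is at least δ exactly when the closest node is within r and within the radius of the level
δ(N+1), where N counts the users of that node. As δ → ∞, ρ tends to 0 and the radius of 2δ is
negligible against ρ. Up to a travelled distance of order 1/ρ it is therefore unlikely that a node
having users is met closely enough, or that two of the relevant discs of radius ρ overlap. Off this
unlikely event (the failure of `IsSparse`), up-crossings are the entrances into discs of radius ρ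
around free nodes, those without users, and they are counted by the free nodes in a tube of
half-width ρ around the path (`encard_upCrossingSet_inter_Iic`).

Given the users, the node counts are Poisson on the user-free region. A tube of length of order 1/ρ
has bounded area but meets each disc of radius 2r in area O(ρ), and being user-free is uncorrelated
for locations more than 2r apart. Hence the free area of the tube has variance O(ρ) and concentrates
at κ times its area (`integral_abs_volume_freeRegion_pathTube_sub_le`). Averaging over the users, in
time rescaled by 2λvρκ, an interval without points is asymptotically independent of the past count
and has probability exp(-length). `IsAsymptoticallyPoisson` records this, together with crude tail
bounds.

The gap law follows without convergence of point processes. Time is cut into cells of length η; the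
n-th point falls in one cell, and the probability that nothing happens during time y after that cell
telescopes over the cells to about exp(-y). Locating the n-th point only up to η costs O(η), and two
points in one of K cells cost O(Kη²) (`tendsto_real_gap_le`).

For fixed δ, the set where the path is at least δ is a locally finite union of intervals. The path
almost surely keeps vanishing around large node-free discs and keeps exceeding δ near free nodes
close to the line, so it up-crosses infinitely often (`ae_upCrossingSet`). -/

/-! ### Counting the points of a configuration -/

theorem natCast_le_encard_iff (s : Set ℕ) (k : ℕ) :
    (k : ℕ∞) ≤ s.encard ↔ ∃ F : Finset ℕ, F.card = k ∧ (F : Set ℕ) ⊆ s := by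
  constructor
  · intro h
    obtain ⟨t, hts, ht⟩ := exists_subset_encard_eq h
    have hfin : t.Finite := finite_of_encard_eq_coe ht
    refine ⟨hfin.toFinset, ?_, by simpa using hts⟩
    have := hfin.encard_eq_coe_toFinset_card
    rw [ht] at this
    exact_mod_cast this.symm
  · rintro ⟨F, rfl, hF⟩
    rw [← encard_coe_eq_coe_finsetCard]
    exact encard_le_encard hF

/-- The cardinality of a random set of indices is measurable. -/
theorem measurable_encard_of_measurableSet_mem {α : Type*} [MeasurableSpace α] {f : α → Set ℕ}
    (hf : ∀ i, MeasurableSet {a | i ∈ f a}) : Measurable (fun a => (f a).encard) := by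
  have hle : ∀ k : ℕ, MeasurableSet {a | (k : ℕ∞) ≤ (f a).encard} := by
    intro k
    have : {a | (k : ℕ∞) ≤ (f a).encard} =
        ⋃ F ∈ {F : Finset ℕ | F.card = k}, ⋂ i ∈ F, {a | i ∈ f a} := by
      ext a
      simp only [mem_ofPred_eq, natCast_le_encard_iff, mem_iUnion, mem_iInter, exists_prop]
      exact exists_congr fun F => and_congr_right fun _ => Iff.rfl
    rw [this]
    exact MeasurableSet.biUnion (to_countable _) fun F _ =>
      Finset.measurableSet_biInter _ fun i _ => hf i
  refine measurable_to_countable' fun x => ?_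
  induction x using ENat.recTopCoe with
  | top =>
    have : (fun a => (f a).encard) ⁻¹' {⊤} = ⋂ k : ℕ, {a | (k : ℕ∞) ≤ (f a).encard} := by
      ext a
      simp only [mem_preimage, mem_singleton_iff, mem_iInter, mem_ofPred_eq]
      exact ⟨fun h k => h ▸ le_top, fun h => ENat.eq_top_iff_forall_ge.2 h⟩
    rw [this]
    exact MeasurableSet.iInter hle
  | coe k =>
    have : (fun a => (f a).encard) ⁻¹' {(k : ℕ∞)} =
        {a | (k : ℕ∞) ≤ (f a).encard} \ {a | ((k + 1 : ℕ) : ℕ∞) ≤ (f a).encard} := by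
      ext a
      simp only [mem_preimage, mem_singleton_iff, Set.mem_sdiff, mem_ofPred_eq, not_le]
      push_cast
      rw [ENat.lt_add_one_iff (ENat.natCast_ne_top k)]
      exact ⟨fun h => ⟨h.ge, h.le⟩, fun h => le_antisymm h.2 h.1⟩
    rw [this]
    exact (hle k).diff (hle (k + 1))

theorem pointCount_eq_zero_iff (x : ℕ → Plane) (B : Set Plane) :
    pointCount x B = 0 ↔ ∀ i, x i ∉ B := by
  simp [pointCount, eq_empty_iff_forall_notMem]

theorem one_le_pointCount_iff (x : ℕ → Plane) (B : Set Plane) :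
    1 ≤ pointCount x B ↔ ∃ i, x i ∈ B := by
  rw [Order.one_le_iff_ne_zero, Ne, pointCount_eq_zero_iff]; push Not; rfl

theorem two_le_pointCount {x : ℕ → Plane} {B : Set Plane} {i j : ℕ} (hij : i ≠ j)
    (hi : x i ∈ B) (hj : x j ∈ B) : 2 ≤ pointCount x B := by
  rw [← encard_pair hij]
  refine encard_le_encard ?_
  rintro k (rfl | rfl) <;> assumption

theorem pointCount_mono (x : ℕ → Plane) {B C : Set Plane} (h : B ⊆ C) :
    pointCount x B ≤ pointCount x C :=
  encard_le_encard fun _ hi => h hi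

theorem pointCount_union (x : ℕ → Plane) {B C : Set Plane} (h : Disjoint B C) :
    pointCount x (B ∪ C) = pointCount x B + pointCount x C := by
  have : {i | x i ∈ B ∪ C} = {i | x i ∈ B} ∪ {i | x i ∈ C} := rfl
  rw [pointCount, this, encard_union_eq]
  · rfl
  · exact Set.disjoint_left.2 fun i hi hi' => Set.disjoint_left.1 h hi hi'

theorem setOf_lt_natCast_eq_iUnion {α : Type*} (f : α → ℕ∞) (n : ℕ) :
    {a | f a < n} = ⋃ k ∈ Finset.range n, {a | f a = (k : ℕ)} := by
  ext a
  simp only [mem_ofPred_eq, mem_iUnion, Finset.mem_range, exists_prop]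
  constructor
  · intro h
    lift f a to ℕ using (h.trans_le le_top).ne with m hm
    exact ⟨m, by exact_mod_cast h, rfl⟩
  · rintro ⟨k, hk, h⟩
    rw [h]; exact_mod_cast hk

/-! ### Estimates for Poisson counts -/

namespace IsPoissonPointProcess

variable {Ω : Type*} [MeasurableSpace Ω] {P : Measure Ω} {X : ℕ → Ω → Plane} {lam : ℝ}

theorem measurable_count (hX : IsPoissonPointProcess P X lam) {B : Set Plane}
    (hB : MeasurableSet B) : Measurable (fun ω => pointCount (fun i => X i ω) B) :=
  measurable_encard_of_measurableSet_mem fun i => hX.measurable_point i hB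

theorem measurableSet_count (hX : IsPoissonPointProcess P X lam) {B : Set Plane}
    (hB : MeasurableSet B) (K : Set ℕ∞) :
    MeasurableSet {ω | pointCount (fun i => X i ω) B ∈ K} :=
  hX.measurable_count hB MeasurableSet.of_discrete

theorem real_count_eq (hX : IsPoissonPointProcess P X lam) (hl : 0 < lam) {B : Set Plane}
    (hB : MeasurableSet B) (hV : volume B ≠ ⊤) (k : ℕ) :
    P.real {ω | pointCount (fun i => X i ω) B = k} =
      Real.exp (-(lam * volume.real B)) * (lam * volume.real B) ^ k / (k.factorial : ℝ) := by
  rw [measureReal_def, hX.count_law B hB hV k, ENNReal.toReal_ofReal]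
  · rfl
  · have : 0 ≤ lam * (volume B).toReal := by positivity
    positivity

theorem real_count_eq_zero (hX : IsPoissonPointProcess P X lam) (hl : 0 < lam) {B : Set Plane}
    (hB : MeasurableSet B) (hV : volume B ≠ ⊤) :
    P.real {ω | pointCount (fun i => X i ω) B = 0} = Real.exp (-(lam * volume.real B)) := by
  simpa using hX.real_count_eq hl hB hV 0

theorem real_count_lt_inter_count_eq_zero (hX : IsPoissonPointProcess P X lam) (hl : 0 < lam)
    {B C : Set Plane} (hB : MeasurableSet B) (hC : MeasurableSet C) (hVC : volume C ≠ ⊤)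
    (hBC : Disjoint B C) (n : ℕ) :
    P.real {ω | pointCount (fun i => X i ω) B < n ∧ pointCount (fun i => X i ω) C = 0} =
      P.real {ω | pointCount (fun i => X i ω) B < n} * Real.exp (-(lam * volume.real C)) := by
  have hind := hX.count_indep 2 ![B, C]
    (by intro i; fin_cases i <;> assumption)
    (by intro i j hij; fin_cases i <;> fin_cases j <;>
        first | exact absurd rfl hij | exact hBC | exact hBC.symm)
  have h := (hind.indepFun (i := 0) (j := 1) (by decide)).measure_inter_preimage_eq_mul
    (Iio (n : ℕ∞)) {0} (MeasurableSet.of_discrete) (measurableSet_singleton 0)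
  rw [← hX.real_count_eq_zero hl hC hVC, measureReal_def, measureReal_def, measureReal_def,
    ← ENNReal.toReal_mul]
  exact congrArg ENNReal.toReal h

variable [IsProbabilityMeasure P]

theorem real_one_le_count (hX : IsPoissonPointProcess P X lam) (hl : 0 < lam) {B : Set Plane}
    (hB : MeasurableSet B) (hV : volume B ≠ ⊤) :
    P.real {ω | 1 ≤ pointCount (fun i => X i ω) B} = 1 - Real.exp (-(lam * volume.real B)) := by
  have h : {ω | 1 ≤ pointCount (fun i => X i ω) B} =
      {ω | pointCount (fun i => X i ω) B = 0}ᶜ := by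
    ext ω; simp [Order.one_le_iff_ne_zero]
  have hms : MeasurableSet {ω | pointCount (fun i => X i ω) B = 0} := hX.measurableSet_count hB {0}
  rw [h, measureReal_compl hms,
    hX.real_count_eq_zero hl hB hV]
  simp

theorem real_one_le_count_le (hX : IsPoissonPointProcess P X lam) (hl : 0 < lam) {B : Set Plane}
    (hB : MeasurableSet B) (hV : volume B ≠ ⊤) :
    P.real {ω | 1 ≤ pointCount (fun i => X i ω) B} ≤ lam * volume.real B := by
  rw [hX.real_one_le_count hl hB hV]
  linarith [Real.add_one_le_exp (-(lam * volume.real B))]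

theorem real_count_lt (hX : IsPoissonPointProcess P X lam) (hl : 0 < lam) {B : Set Plane}
    (hB : MeasurableSet B) (hV : volume B ≠ ⊤) (n : ℕ) :
    P.real {ω | pointCount (fun i => X i ω) B < n} =
      ∑ k ∈ Finset.range n,
        Real.exp (-(lam * volume.real B)) * (lam * volume.real B) ^ k / (k.factorial : ℝ) := by
  rw [setOf_lt_natCast_eq_iUnion, measureReal_biUnion_finset]
  · exact Finset.sum_congr rfl fun k _ => hX.real_count_eq hl hB hV k
  · intro i _ j _ hij
    refine Set.disjoint_left.2 fun ω hi hj => hij ?_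
    simp only [mem_ofPred_eq] at hi hj
    rw [hi] at hj
    exact_mod_cast hj
  · exact fun k _ => hX.measurable_count hB (measurableSet_singleton (k : ℕ∞))

/-- With mean m the probability is 1 - exp(-m)(1 + m), and exp(-m) ≥ 1 - m bounds it by 1 - (1 -
m)(1 + m) = m². The quadratic order makes close pairs of nodes, and two points in a short cell,
negligible. -/
theorem real_two_le_count_le (hX : IsPoissonPointProcess P X lam) (hl : 0 < lam) {B : Set Plane}
    (hB : MeasurableSet B) (hV : volume B ≠ ⊤) :
    P.real {ω | 2 ≤ pointCount (fun i => X i ω) B} ≤ (lam * volume.real B) ^ 2 := by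
  have h : {ω | 2 ≤ pointCount (fun i => X i ω) B} =
      {ω | pointCount (fun i => X i ω) B < (2 : ℕ)}ᶜ := by
    ext ω; simp only [mem_ofPred_eq, mem_compl_iff, not_lt]; rfl
  have hms : MeasurableSet {ω | pointCount (fun i => X i ω) B < (2 : ℕ)} :=
    hX.measurableSet_count hB (Iio (2 : ℕ))
  rw [h, measureReal_compl hms,
    hX.real_count_lt hl hB hV]
  set m := lam * volume.real B
  have hm : 0 ≤ m := by positivity
  simp only [Finset.sum_range_succ, Finset.sum_range_zero, probReal_univ]
  have h1 := Real.add_one_le_exp (-m)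
  norm_num
  nlinarith

/-- Half of the exponential is spent on (m/2)^k / k! ≤ exp(m/2); the other half remains, and the
factors 2^k sum to less than 2^n. Only the decay in m matters later. -/
theorem real_count_lt_le (hX : IsPoissonPointProcess P X lam) (hl : 0 < lam) {B : Set Plane}
    (hB : MeasurableSet B) (hV : volume B ≠ ⊤) (n : ℕ) :
    P.real {ω | pointCount (fun i => X i ω) B < n} ≤
      2 ^ n * Real.exp (-(lam * volume.real B) / 2) := by
  rw [hX.real_count_lt hl hB hV]
  set m := lam * volume.real B
  have hm : 0 ≤ m := by positivity
  have key : ∀ k ∈ Finset.range n, Real.exp (-m) * m ^ k / (k.factorial : ℝ) ≤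
      2 ^ k * Real.exp (-m / 2) := by
    intro k _
    have h1 : (m / 2) ^ k / (k.factorial : ℝ) ≤ Real.exp (m / 2) :=
      Real.pow_div_factorial_le_exp (m / 2) (by positivity) k
    have h2 : Real.exp (-m) = Real.exp (-m / 2) * Real.exp (-m / 2) := by
      rw [← Real.exp_add]; ring_nf
    have h3 : Real.exp (-m / 2) * Real.exp (m / 2) = 1 := by
      rw [← Real.exp_add]; ring_nf; exact Real.exp_zero
    have h4 : m ^ k = 2 ^ k * (m / 2) ^ k := by rw [← mul_pow]; ring_nf
    calc Real.exp (-m) * m ^ k / (k.factorial : ℝ)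
        = 2 ^ k * Real.exp (-m / 2) * (Real.exp (-m / 2) * ((m / 2) ^ k / (k.factorial : ℝ))) := by
          rw [h2, h4]; ring
      _ ≤ 2 ^ k * Real.exp (-m / 2) * (Real.exp (-m / 2) * Real.exp (m / 2)) := by gcongr
      _ = _ := by rw [h3, mul_one]
  refine (Finset.sum_le_sum key).trans ?_
  rw [← Finset.sum_mul]
  gcongr
  have : ∑ i ∈ Finset.range n, (2 : ℝ) ^ i = 2 ^ n - 1 := by
    rw [geom_sum_eq (by norm_num)]; norm_num
  rw [this]; linarith

/-- The count law speaks of finite values only, but its Poisson weights already sum to one, leaving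
no mass for `⊤`. -/
theorem ae_count_ne_top (hX : IsPoissonPointProcess P X lam) (hl : 0 < lam) {B : Set Plane}
    (hB : MeasurableSet B) (hV : volume B ≠ ⊤) :
    ∀ᵐ ω ∂P, pointCount (fun i => X i ω) B ≠ ⊤ := by
  set m := lam * volume.real B with hm_def
  have hm : 0 ≤ m := by positivity
  have hms : ∀ k : ℕ, MeasurableSet {ω | pointCount (fun i => X i ω) B = (k : ℕ)} := fun k =>
    hX.measurable_count hB (measurableSet_singleton (k : ℕ∞))
  have hset : {ω | pointCount (fun i => X i ω) B ≠ ⊤} =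
      ⋃ k : ℕ, {ω | pointCount (fun i => X i ω) B = (k : ℕ)} := by
    ext ω
    simp only [mem_ofPred_eq, mem_iUnion, ENat.ne_top_iff_exists]
    exact exists_congr fun _ => eq_comm
  have hmeas : MeasurableSet {ω | pointCount (fun i => X i ω) B ≠ ⊤} := by
    rw [hset]; exact MeasurableSet.iUnion hms
  have h1 : P {ω | pointCount (fun i => X i ω) B ≠ ⊤} = 1 := by
    rw [hset, measure_iUnion _ hms]
    · have h2 : ∀ k : ℕ, P {ω | pointCount (fun i => X i ω) B = (k : ℕ)} =
          ENNReal.ofReal (Real.exp (-m) * (m ^ k / (k.factorial : ℝ))) := by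
        intro k; rw [hX.count_law B hB hV k, ← mul_div_assoc]; rfl
      simp_rw [h2]
      rw [← ENNReal.ofReal_tsum_of_nonneg (fun k => by positivity)
        ((Real.summable_pow_div_factorial m).mul_left _), tsum_mul_left]
      have : ∑' k : ℕ, m ^ k / (k.factorial : ℝ) = Real.exp m := by
        rw [Real.exp_eq_exp_ℝ, NormedSpace.exp_eq_tsum_div]
      rw [this, ← Real.exp_add]; simp
    · intro i j hij
      refine Set.disjoint_left.2 fun ω hi hj => hij ?_
      simp only [mem_ofPred_eq] at hi hj
      rw [hi] at hj
      exact_mod_cast hj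
  exact (prob_compl_eq_zero_iff hmeas).2 h1

theorem ae_finite_closedBall (hX : IsPoissonPointProcess P X lam) (hl : 0 < lam) :
    ∀ᵐ ω ∂P, ∀ (y : Plane) (r : ℝ), {i | X i ω ∈ Metric.closedBall y r}.Finite := by
  have h : ∀ᵐ ω ∂P, ∀ n : ℕ, pointCount (fun i => X i ω) (Metric.closedBall 0 (n : ℝ)) ≠ ⊤ :=
    ae_all_iff.2 fun n => hX.ae_count_ne_top hl Metric.isClosed_closedBall.measurableSet
      measure_closedBall_lt_top.ne
  filter_upwards [h] with ω hω y r
  obtain ⟨n, hn⟩ := exists_nat_ge (r + dist y 0)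
  refine Finite.subset (encard_ne_top_iff.1 (hω n)) fun i hi => ?_
  exact Metric.closedBall_subset_closedBall' hn hi

theorem ae_forall_notMem (hX : IsPoissonPointProcess P X lam) (hl : 0 < lam) {B : Set Plane}
    (hB : MeasurableSet B) (hV : volume B = 0) : ∀ᵐ ω ∂P, ∀ i, X i ω ∉ B := by
  have h := hX.real_one_le_count_le hl hB (by simp [hV])
  rw [measureReal_def (μ := volume), hV] at h
  have h0 : P {ω | 1 ≤ pointCount (fun i => X i ω) B} = 0 := by
    refine (measureReal_eq_zero_iff (measure_ne_top _ _)).1 (le_antisymm ?_ measureReal_nonneg)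
    simpa using h
  filter_upwards [measure_eq_zero_iff_ae_notMem.1 h0] with ω hω i hi
  exact hω ((one_le_pointCount_iff _ _).2 ⟨i, hi⟩)

/-- Among infinitely many disjoint sets of the same area, infinitely many contain no point. -/
theorem ae_frequently_count_eq_zero (hX : IsPoissonPointProcess P X lam) (hl : 0 < lam)
    {B : ℕ → Set Plane} (hB : ∀ k, MeasurableSet (B k)) {V : ENNReal} (hV : V ≠ ⊤)
    (hBV : ∀ k, volume (B k) = V) (hd : Pairwise fun i j => Disjoint (B i) (B j)) :
    ∀ᵐ ω ∂P, ∀ m, ∃ k ≥ m, ∀ i, X i ω ∉ B k := by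
  refine ae_all_iff.2 fun m => ?_
  set q := Real.exp (-(lam * V.toReal))
  have hq : 0 < q := Real.exp_pos _
  have hq1 : q ≤ 1 := Real.exp_le_one_iff.2 (by have := V.toReal_nonneg; nlinarith)
  set A : Set Ω := {ω | ¬ ∃ k ≥ m, ∀ i, X i ω ∉ B k}
  -- On `A`, each of the n disjoint sets from index m on contains a point; these are independent
  -- events of probability 1 - q.
  have hA : ∀ n : ℕ, P.real A ≤ (1 - q) ^ n := by
    intro n
    have hind := hX.count_indep n (fun i => B (m + i)) (fun i => hB _)
      (fun i j hij => hd fun h => hij (Fin.ext (by omega)))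
    have h := hind.measure_inter_preimage_eq_mul Finset.univ (sets := fun _ => Ici 1)
      (fun _ _ => MeasurableSet.of_discrete)
    have hsub : A ⊆ ⋂ i ∈ (Finset.univ : Finset (Fin n)),
        (fun ω => pointCount (fun l => X l ω) (B (m + i))) ⁻¹' Ici 1 := by
      intro ω hω
      simp only [mem_iInter, mem_preimage, mem_Ici]
      intro i _
      rw [one_le_pointCount_iff]
      by_contra! hcon
      exact hω ⟨m + i, by omega, hcon⟩
    refine (measureReal_mono hsub).trans ?_
    rw [measureReal_def, h, ENNReal.toReal_prod]
    have : ∀ i : Fin n, (P ((fun ω => pointCount (fun l => X l ω) (B (m + i))) ⁻¹' Ici 1)).toReal =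
        1 - q := by
      intro i
      have := hX.real_one_le_count hl (hB (m + i)) (by rw [hBV]; exact hV)
      rw [measureReal_def (μ := volume), hBV] at this
      exact this
    simp [this]
  have hlim : Tendsto (fun n : ℕ => (1 - q) ^ n) atTop (𝓝 0) :=
    tendsto_pow_atTop_nhds_zero_of_lt_one (by linarith) (by linarith)
  have h0 : P.real A ≤ 0 := ge_of_tendsto' hlim hA
  exact (measureReal_eq_zero_iff (measure_ne_top _ _)).1 (le_antisymm h0 measureReal_nonneg)

end IsPoissonPointProcess

/-! ### Coordinates along and across the path -/

/-- The set of the points whose first coordinate in the basis `b` lies in `I` and whose second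
coordinate lies in `J`. -/
def coordBox (b : OrthonormalBasis (Fin 2) ℝ Plane) (I J : Set ℝ) : Set Plane :=
  {y | b.repr y 0 ∈ I ∧ b.repr y 1 ∈ J}

section CoordBox

variable (b : OrthonormalBasis (Fin 2) ℝ Plane)

theorem measurable_coord (i : Fin 2) : Measurable fun y : Plane => b.repr y i :=
  (by fun_prop : Continuous fun y : Plane => b.repr y i).measurable

theorem measurableSet_coordBox {I J : Set ℝ} (hI : MeasurableSet I) (hJ : MeasurableSet J) :
    MeasurableSet (coordBox b I J) :=
  (measurable_coord b 0 hI).inter (measurable_coord b 1 hJ)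

theorem volume_coordBox {I J : Set ℝ} (hI : MeasurableSet I) (hJ : MeasurableSet J) :
    volume (coordBox b I J) = volume I * volume J := by
  have hmp : MeasurePreserving (fun y : Plane => WithLp.ofLp (b.repr y)) volume volume :=
    (PiLp.volume_preserving_ofLp (Fin 2)).comp b.measurePreserving_repr
  have hms : MeasurableSet (Set.pi univ ![I, J]) := by
    refine MeasurableSet.univ_pi fun i => ?_
    fin_cases i <;> assumption
  have hpre : coordBox b I J = (fun y : Plane => WithLp.ofLp (b.repr y)) ⁻¹' Set.pi univ ![I, J] := by
    ext y
    simp [coordBox, Fin.forall_fin_two]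
  rw [hpre, hmp.measure_preimage hms.nullMeasurableSet, volume_pi_pi]
  simp [Fin.prod_univ_two]

theorem volume_real_coordBox {I J : Set ℝ} (hI : MeasurableSet I) (hJ : MeasurableSet J) :
    volume.real (coordBox b I J) = volume.real I * volume.real J := by
  rw [measureReal_def, volume_coordBox b hI hJ, ENNReal.toReal_mul]; rfl

theorem dist_sq_eq_coord (y z : Plane) :
    dist y z ^ 2 = (b.repr y 0 - b.repr z 0) ^ 2 + (b.repr y 1 - b.repr z 1) ^ 2 := by
  rw [← b.repr.dist_map y z, EuclideanSpace.dist_eq, Real.sq_sqrt (by positivity)]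
  simp [Fin.sum_univ_two, Real.dist_eq, sq_abs]

theorem abs_coord_sub_le_dist (y z : Plane) (i : Fin 2) :
    |b.repr y i - b.repr z i| ≤ dist y z := by
  refine abs_le_of_sq_le_sq ?_ dist_nonneg
  have h := dist_sq_eq_coord b y z
  fin_cases i <;> simp <;> nlinarith [sq_nonneg (b.repr y 0 - b.repr z 0), sq_nonneg (b.repr y 1 - b.repr z 1)]

end CoordBox

/-- Choosing the direction of motion as first basis vector turns the path into the first coordinate
axis, so that the second coordinate measures the distance to the line. -/
theorem exists_orthonormalBasis_zero_eq {u : Plane} (hu : ‖u‖ = 1) :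
    ∃ b : OrthonormalBasis (Fin 2) ℝ Plane, b 0 = u := by
  have h : Orthonormal ℝ (({0} : Set (Fin 2)).domRestrict fun _ => u) := by
    constructor
    · intro i; simpa using hu
    · intro i j hij; exact absurd (Subsingleton.elim i j) hij
  obtain ⟨b, hb⟩ := h.exists_orthonormalBasis_extension_of_card_eq (by simp)
  exact ⟨b, hb 0 rfl⟩

theorem NetworkParams.coord_position (M : NetworkParams) {b : OrthonormalBasis (Fin 2) ℝ Plane}
    (hb : b 0 = M.dir) (t : ℝ) :
    b.repr (M.position t) 0 = M.v * t ∧ b.repr (M.position t) 1 = 0 := by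
  simp [NetworkParams.position, ← hb]

theorem NetworkParams.dist_position_sq (M : NetworkParams)
    {b : OrthonormalBasis (Fin 2) ℝ Plane} (hb : b 0 = M.dir) (t : ℝ) (y : Plane) :
    dist (M.position t) y ^ 2 = (M.v * t - b.repr y 0) ^ 2 + b.repr y 1 ^ 2 := by
  rw [dist_sq_eq_coord b, (M.coord_position hb t).1, (M.coord_position hb t).2]; ring

/-! ### The user-free region and the concentration of its area -/

/-- The set of the locations that have no point of the configuration `u` within distance `r`. -/
def freeRegion (r : ℝ) (u : ℕ → Plane) : Set Plane :=
  {y | ∀ j, r < dist y (u j)}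

theorem measurableSet_mem_freeRegion {α : Type*} [MeasurableSpace α] (r : ℝ)
    {g : α → Plane} {u : ℕ → α → Plane} (hg : Measurable g) (hu : ∀ j, Measurable (u j)) :
    MeasurableSet {a | g a ∈ freeRegion r (fun j => u j a)} := by
  have : {a | g a ∈ freeRegion r (fun j => u j a)} = ⋂ j, {a | r < dist (g a) (u j a)} := by
    ext a; simp [freeRegion]
  rw [this]
  exact MeasurableSet.iInter fun j => measurableSet_lt measurable_const (hg.dist (hu j))

theorem measurableSet_freeRegion (r : ℝ) (u : ℕ → Plane) : MeasurableSet (freeRegion r u) :=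
  measurableSet_mem_freeRegion r measurable_id fun _ => measurable_const

theorem mem_freeRegion_iff_pointCount (r : ℝ) (u : ℕ → Plane) (y : Plane) :
    y ∈ freeRegion r u ↔ pointCount u (Metric.closedBall y r) = 0 := by
  rw [pointCount_eq_zero_iff]
  simp [freeRegion, dist_comm]

theorem volume_real_closedBall (y : Plane) {r : ℝ} (hr : 0 ≤ r) :
    volume.real (Metric.closedBall y r) = Real.pi * r ^ 2 := by
  rw [measureReal_def, EuclideanSpace.volume_closedBall_fin_two, ENNReal.toReal_mul,
    ENNReal.toReal_pow, ENNReal.toReal_ofReal hr, ENNReal.toReal_ofReal Real.pi_pos.le, mul_comm]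

theorem integral_le_sqrt_integral_sq {Ω : Type*} [MeasurableSpace Ω] {P : Measure Ω}
    [IsProbabilityMeasure P] {g : Ω → ℝ} (hg : Integrable g P)
    (hg2 : Integrable (fun ω => g ω ^ 2) P) : ∫ ω, g ω ∂P ≤ √(∫ ω, g ω ^ 2 ∂P) := by
  refine Real.le_sqrt_of_sq_le ?_
  set c := ∫ ω, g ω ∂P with hc
  have h0 : 0 ≤ ∫ ω, (g ω - c) ^ 2 ∂P := integral_nonneg fun ω => sq_nonneg _
  have h1 : ∫ ω, (g ω - c) ^ 2 ∂P = ∫ ω, g ω ^ 2 ∂P - c ^ 2 := by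
    have : ∀ ω, (g ω - c) ^ 2 = g ω ^ 2 - (2 * c * g ω - c ^ 2) := fun ω => by ring
    simp_rw [this]
    have hi : Integrable (fun ω => 2 * c * g ω) P := hg.const_mul _
    have hi' : Integrable (fun ω => 2 * c * g ω - c ^ 2) P := hi.sub (integrable_const _)
    rw [integral_sub hg2 hi',
      integral_sub hi (integrable_const _), integral_const_mul, ← hc]
    simp; ring
  linarith

/-- The integral of a bounded random field with short-range correlations is small. -/
theorem integral_abs_integral_le_sqrt {Ω : Type*} [MeasurableSpace Ω] {P : Measure Ω}
    [IsProbabilityMeasure P] {f : Ω → Plane → ℝ} (hfm : Measurable fun p : Ω × Plane => f p.1 p.2)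
    (hf1 : ∀ ω y, ‖f ω y‖ ≤ 1) {R W : ℝ}
    (hcov : ∀ y z, ∫ ω, f ω y * f ω z ∂P ≤ (Metric.closedBall y R).indicator 1 z)
    (ν : Measure Plane) [IsFiniteMeasure ν] (hW : ∀ y, ν.real (Metric.closedBall y R) ≤ W) :
    ∫ ω, |∫ y, f ω y ∂ν| ∂P ≤ √(W * ν.real univ) := by
  have hgm : StronglyMeasurable fun ω => ∫ y, f ω y ∂ν :=
    hfm.stronglyMeasurable.integral_prod_right
  have hgb : ∀ ω, ‖∫ y, f ω y ∂ν‖ ≤ ν.real univ := fun ω => by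
    simpa using norm_integral_le_of_norm_le_const (μ := ν) (Eventually.of_forall (hf1 ω))
  have hgint : Integrable (fun ω => ∫ y, f ω y ∂ν) P :=
    Integrable.of_bound hgm.aestronglyMeasurable _ (Eventually.of_forall hgb)
  have hg2int : Integrable (fun ω => (∫ y, f ω y ∂ν) ^ 2) P :=
    Integrable.of_bound (hgm.pow 2).aestronglyMeasurable (ν.real univ ^ 2)
      (Eventually.of_forall fun ω => by
        rw [norm_pow]; exact pow_le_pow_left₀ (norm_nonneg _) (hgb ω) 2)
  have hff : Measurable fun p : Ω × (Plane × Plane) => f p.1 p.2.1 * f p.1 p.2.2 :=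
    (hfm.comp (measurable_fst.prodMk (measurable_fst.comp measurable_snd))).mul
      (hfm.comp (measurable_fst.prodMk (measurable_snd.comp measurable_snd)))
  have hffb : ∀ ω (z : Plane × Plane), ‖f ω z.1 * f ω z.2‖ ≤ 1 := fun ω z => by
    rw [norm_mul]; exact mul_le_one₀ (hf1 _ _) (norm_nonneg _) (hf1 _ _)
  -- By Fubini, the second moment of the spatial integral is the double spatial integral of the
  -- products' expectations, to which `hcov` applies.
  have hsq : ∫ ω, (∫ y, f ω y ∂ν) ^ 2 ∂P = ∫ z, ∫ ω, f ω z.1 * f ω z.2 ∂P ∂(ν.prod ν) := by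
    rw [← integral_integral_swap]
    · refine integral_congr_ae (Eventually.of_forall fun ω => ?_)
      simp only [sq]
      exact (integral_prod_mul (f ω) (f ω)).symm
    · exact Integrable.of_bound hff.aestronglyMeasurable 1
        (Eventually.of_forall fun p => hffb p.1 p.2)
  have hbint : Integrable (fun z : Plane × Plane =>
      (Metric.closedBall z.1 R).indicator (1 : Plane → ℝ) z.2) (ν.prod ν) := by
    have hbm : MeasurableSet {z : Plane × Plane | dist z.2 z.1 ≤ R} :=
      measurableSet_le (measurable_snd.dist measurable_fst) measurable_const
    exact (integrable_const (1 : ℝ)).indicator hbm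
  -- Only pairs at distance at most R contribute, so the inner integral is at most the `ν`-mass of a
  -- ball.
  have hE : ∫ ω, (∫ y, f ω y ∂ν) ^ 2 ∂P ≤ W * ν.real univ := by
    rw [hsq]
    refine (integral_mono ?_ hbint fun z => hcov z.1 z.2).trans ?_
    · refine Integrable.of_bound
        (hff.stronglyMeasurable.integral_prod_left).aestronglyMeasurable 1
        (Eventually.of_forall fun z => ?_)
      simpa using norm_integral_le_of_norm_le_const (μ := P)
        (Eventually.of_forall fun ω => hffb ω z)
    · rw [integral_prod _ hbint]
      have : ∀ y, ∫ z, (Metric.closedBall y R).indicator (1 : Plane → ℝ) z ∂ν ≤ W := by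
        intro y
        rw [integral_indicator_one Metric.isClosed_closedBall.measurableSet]
        exact hW y
      refine (integral_mono hbint.integral_prod_left (integrable_const W) this).trans ?_
      simp [mul_comm]
  have h2 := integral_le_sqrt_integral_sq hgint.abs (by simpa only [sq_abs] using hg2int)
  simp_rw [sq_abs] at h2
  exact h2.trans (Real.sqrt_le_sqrt hE)

namespace IsPoissonPointProcess

variable {Ω : Type*} [MeasurableSpace Ω] {P : Measure Ω} {U : ℕ → Ω → Plane} {xi r : ℝ}

theorem real_mem_freeRegion (hU : IsPoissonPointProcess P U xi) (hxi : 0 < xi) (hr : 0 ≤ r)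
    (y : Plane) : P.real {ω | y ∈ freeRegion r (fun j => U j ω)} =
      Real.exp (-(xi * Real.pi * r ^ 2)) := by
  simp_rw [mem_freeRegion_iff_pointCount]
  rw [hU.real_count_eq_zero hxi Metric.isClosed_closedBall.measurableSet
    measure_closedBall_lt_top.ne, volume_real_closedBall y hr]
  ring_nf

/-- The two discs of radius r are disjoint, and both are empty exactly when their union is, so the
void probability factorises. -/
theorem real_mem_freeRegion_inter (hU : IsPoissonPointProcess P U xi) (hxi : 0 < xi) (hr : 0 ≤ r)
    {y z : Plane} (hyz : 2 * r < dist y z) :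
    P.real {ω | y ∈ freeRegion r (fun j => U j ω) ∧ z ∈ freeRegion r (fun j => U j ω)} =
      Real.exp (-(xi * Real.pi * r ^ 2)) ^ 2 := by
  have hd : Disjoint (Metric.closedBall y r) (Metric.closedBall z r) :=
    Metric.closedBall_disjoint_closedBall (by linarith)
  have hms : ∀ y : Plane, MeasurableSet (Metric.closedBall y r) :=
    fun y => Metric.isClosed_closedBall.measurableSet
  have hset : {ω | y ∈ freeRegion r (fun j => U j ω) ∧ z ∈ freeRegion r (fun j => U j ω)} =
      {ω | pointCount (fun j => U j ω) (Metric.closedBall y r ∪ Metric.closedBall z r) = 0} := by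
    ext ω
    simp only [mem_ofPred_eq, mem_freeRegion_iff_pointCount, pointCount_union _ hd]
    rw [add_eq_zero]
  rw [hset, hU.real_count_eq_zero hxi ((hms y).union (hms z))
    (measure_union_lt_top measure_closedBall_lt_top measure_closedBall_lt_top).ne,
    measureReal_union hd (hms z) measure_closedBall_lt_top.ne measure_closedBall_lt_top.ne,
    volume_real_closedBall y hr, volume_real_closedBall z hr, ← Real.exp_nat_mul]
  congr 1; push_cast; ring

variable [IsProbabilityMeasure P]

/-- This is the short-range covariance bound: within distance 2r the product of centred indicators
is trivially at most one, and beyond it the covariance vanishes. -/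
theorem integral_indicator_freeRegion_mul_le (hU : IsPoissonPointProcess P U xi) (hxi : 0 < xi)
    (hr : 0 ≤ r) (y z : Plane) :
    ∫ ω, ((freeRegion r (fun j => U j ω)).indicator 1 y - Real.exp (-(xi * Real.pi * r ^ 2))) *
        ((freeRegion r (fun j => U j ω)).indicator 1 z - Real.exp (-(xi * Real.pi * r ^ 2))) ∂P ≤
      (Metric.closedBall y (2 * r)).indicator (1 : Plane → ℝ) z := by
  have hκ0 : 0 ≤ Real.exp (-(xi * Real.pi * r ^ 2)) := (Real.exp_pos _).le
  have hκ1 : Real.exp (-(xi * Real.pi * r ^ 2)) ≤ 1 :=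
    Real.exp_le_one_iff.2 (by have := Real.pi_pos; simp; positivity)
  have hEI := fun y => hU.real_mem_freeRegion hxi hr y
  have hII0 := hU.real_mem_freeRegion_inter hxi hr (y := y) (z := z)
  generalize Real.exp (-(xi * Real.pi * r ^ 2)) = κ at *
  have hmy : ∀ y, MeasurableSet {ω | y ∈ freeRegion r (fun j => U j ω)} := fun y =>
    measurableSet_mem_freeRegion r measurable_const hU.measurable_point
  by_cases hyz : dist y z ≤ 2 * r
  · rw [indicator_of_mem (by rwa [Metric.mem_closedBall, dist_comm])]
    have hb : ∀ ω y, |(freeRegion r (fun j => U j ω)).indicator (1 : Plane → ℝ) y - κ| ≤ 1 := by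
      intro ω y
      have h0 : 0 ≤ (freeRegion r (fun j => U j ω)).indicator (1 : Plane → ℝ) y :=
        indicator_nonneg (fun _ _ => zero_le_one) _
      have h1 : (freeRegion r (fun j => U j ω)).indicator (1 : Plane → ℝ) y ≤ 1 :=
        indicator_le_self' (fun _ _ => zero_le_one) _
      rw [abs_le]; constructor <;> linarith
    have h := norm_integral_le_of_norm_le_const (μ := P) (C := 1)
      (f := fun ω => ((freeRegion r (fun j => U j ω)).indicator 1 y - κ) *
        ((freeRegion r (fun j => U j ω)).indicator 1 z - κ))
      (Eventually.of_forall fun ω => by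
        rw [norm_mul]; exact mul_le_one₀ (hb ω y) (norm_nonneg _) (hb ω z))
    simp only [probReal_univ, mul_one] at h
    exact (le_abs_self _).trans h
  · rw [indicator_of_notMem (by rwa [Metric.mem_closedBall, dist_comm])]
    have hi : ∀ y, Integrable (fun ω => (freeRegion r (fun j => U j ω)).indicator (1 : Plane → ℝ) y) P :=
      fun y => (integrable_const (1 : ℝ)).indicator (hmy y)
    have hIIeq : (fun ω => (freeRegion r (fun j => U j ω)).indicator (1 : Plane → ℝ) y *
          (freeRegion r (fun j => U j ω)).indicator 1 z) =
        {ω | y ∈ freeRegion r (fun j => U j ω) ∧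
          z ∈ freeRegion r (fun j => U j ω)}.indicator 1 := by
      funext ω
      simp only [indicator, mem_ofPred_eq, Pi.one_apply]
      split_ifs <;> simp_all
    have hII := integral_indicator_one (μ := P) ((hmy y).inter (hmy z))
    have hIIint : Integrable (fun ω => (freeRegion r (fun j => U j ω)).indicator (1 : Plane → ℝ) y *
          (freeRegion r (fun j => U j ω)).indicator 1 z) P := by
      rw [hIIeq]; exact (integrable_const (1 : ℝ)).indicator ((hmy y).inter (hmy z))
    have hII' : ∫ ω, (freeRegion r (fun j => U j ω)).indicator (1 : Plane → ℝ) y *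
          (freeRegion r (fun j => U j ω)).indicator 1 z ∂P = κ ^ 2 := by
      rw [hIIeq, ← hII0 (not_le.1 hyz)]; exact hII
    have hI : ∀ y, ∫ ω, (freeRegion r (fun j => U j ω)).indicator (1 : Plane → ℝ) y ∂P = κ :=
      fun y => (integral_indicator_one (hmy y)).trans (hEI y)
    have hexp : ∀ a c : ℝ, (a - κ) * (c - κ) = a * c - (κ * a + (κ * c - κ ^ 2)) :=
      fun a c => by ring
    simp only [hexp]
    have i1 := (hi y).const_mul κ
    have i2 := (hi z).const_mul κ
    have i3 : Integrable (fun ω =>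
        κ * (freeRegion r fun j => U j ω).indicator (1 : Plane → ℝ) z - κ ^ 2) P :=
      i2.sub (integrable_const (κ ^ 2))
    have i4 : Integrable (fun ω => κ * (freeRegion r fun j => U j ω).indicator (1 : Plane → ℝ) y +
        (κ * (freeRegion r fun j => U j ω).indicator (1 : Plane → ℝ) z - κ ^ 2)) P := i1.add i3
    rw [integral_sub hIIint i4, integral_add i1 i3, integral_sub i2 (integrable_const _),
      integral_const_mul, integral_const_mul, hII', hI, hI]
    simp; linarith [sq κ]

/-- The area of the part of `T` that is free of points concentrates around its mean if `T` has a
small part in each disc of radius `2 * r`. -/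
theorem integral_abs_volume_freeRegion_sub_le (hU : IsPoissonPointProcess P U xi) (hxi : 0 < xi)
    (hr : 0 ≤ r) {T : Set Plane} (hVT : volume T ≠ ⊤) {W : ℝ}
    (hW : ∀ y, volume.real (T ∩ Metric.closedBall y (2 * r)) ≤ W) :
    ∫ ω, |volume.real (freeRegion r (fun j => U j ω) ∩ T) -
        Real.exp (-(xi * Real.pi * r ^ 2)) * volume.real T| ∂P ≤ √(W * volume.real T) := by
  have hcov := hU.integral_indicator_freeRegion_mul_le hxi hr
  have hκ0 : 0 ≤ Real.exp (-(xi * Real.pi * r ^ 2)) := (Real.exp_pos _).le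
  have hκ1 : Real.exp (-(xi * Real.pi * r ^ 2)) ≤ 1 :=
    Real.exp_le_one_iff.2 (by have := Real.pi_pos; simp; positivity)
  generalize Real.exp (-(xi * Real.pi * r ^ 2)) = κ at *
  have : IsFiniteMeasure (volume.restrict T) := isFiniteMeasure_restrict.2 hVT
  have hIm : Measurable fun p : Ω × Plane =>
      (freeRegion r (fun j => U j p.1)).indicator (1 : Plane → ℝ) p.2 := by
    have hs : MeasurableSet {p : Ω × Plane | p.2 ∈ freeRegion r (fun j => U j p.1)} :=
      measurableSet_mem_freeRegion r measurable_snd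
        fun j => (hU.measurable_point j).comp measurable_fst
    exact (measurable_const (a := (1 : ℝ))).indicator hs
  have hb : ∀ ω y, ‖(freeRegion r (fun j => U j ω)).indicator (1 : Plane → ℝ) y - κ‖ ≤ 1 := by
    intro ω y
    have h0 : 0 ≤ (freeRegion r (fun j => U j ω)).indicator (1 : Plane → ℝ) y :=
      indicator_nonneg (fun _ _ => zero_le_one) _
    have h1 : (freeRegion r (fun j => U j ω)).indicator (1 : Plane → ℝ) y ≤ 1 :=
      indicator_le_self' (fun _ _ => zero_le_one) _
    rw [Real.norm_eq_abs, abs_le]; constructor <;> linarith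
  have h := integral_abs_integral_le_sqrt (hIm.sub_const κ) hb hcov (volume.restrict T) (W := W)
    (fun y => by
      rw [measureReal_restrict_apply Metric.isClosed_closedBall.measurableSet, inter_comm]
      exact hW y)
  rw [measureReal_restrict_apply_univ] at h
  refine le_trans (le_of_eq ?_) h
  refine integral_congr_ae (Eventually.of_forall fun ω => ?_)
  have hi : Integrable ((freeRegion r fun j => U j ω).indicator (1 : Plane → ℝ))
      (volume.restrict T) :=
    (integrable_const (1 : ℝ)).indicator (measurableSet_freeRegion r _)
  simp only
  rw [integral_sub hi (integrable_const _), integral_indicator_one (measurableSet_freeRegion r _),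
    measureReal_restrict_apply (measurableSet_freeRegion r _)]
  simp [mul_comm]

end IsPoissonPointProcess

/-! ### Free nodes, conditionally on the users -/

/-- The number of points of `x` in `T` that have no point of `u` within distance `r`. -/
noncomputable def freeCount (r : ℝ) (x u : ℕ → Plane) (T : Set Plane) : ℕ∞ :=
  pointCount x (freeRegion r u ∩ T)

/-- Measurability is needed jointly in the two configurations, so that Fubini can freeze the users.
-/
theorem measurable_freeCount (r : ℝ) {T : Set Plane} (hT : MeasurableSet T) :
    Measurable fun q : (ℕ → Plane) × (ℕ → Plane) => freeCount r q.1 q.2 T := by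
  refine measurable_encard_of_measurableSet_mem fun i => ?_
  have hi : Measurable fun q : (ℕ → Plane) × (ℕ → Plane) => q.1 i :=
    (measurable_pi_apply i).comp measurable_fst
  exact (measurableSet_mem_freeRegion r hi fun j => (measurable_pi_apply j).comp measurable_snd).inter
    (hi hT)

theorem freeCount_le_pointCount (r : ℝ) (x u : ℕ → Plane) (T : Set Plane) :
    freeCount r x u T ≤ pointCount x T :=
  pointCount_mono x inter_subset_right

theorem freeCount_union (r : ℝ) (x u : ℕ → Plane) {S T : Set Plane} (h : Disjoint S T) :
    freeCount r x u (S ∪ T) = freeCount r x u S + freeCount r x u T := by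
  rw [freeCount, inter_union_distrib_left, pointCount_union]
  · rfl
  · exact h.mono inter_subset_right inter_subset_right

theorem IsPoissonPointProcess.measurable_freeCount_process {Ω : Type*} [MeasurableSpace Ω]
    {P : Measure Ω} {X U : ℕ → Ω → Plane} {lam xi : ℝ} (hX : IsPoissonPointProcess P X lam)
    (hU : IsPoissonPointProcess P U xi) (r : ℝ) {T : Set Plane} (hT : MeasurableSet T) :
    Measurable fun ω => freeCount r (fun i => X i ω) (fun j => U j ω) T :=
  measurable_encard_of_measurableSet_mem fun i =>
    (measurableSet_mem_freeRegion r (hX.measurable_point i) hU.measurable_point).inter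
      (hX.measurable_point i hT)

theorem measurable_volume_freeRegion_inter {Ω : Type*} [MeasurableSpace Ω] (r : ℝ)
    {U : ℕ → Ω → Plane} (hU : ∀ j, Measurable (U j)) {T : Set Plane} (hT : MeasurableSet T) :
    Measurable fun ω => volume.real (freeRegion r (fun j => U j ω) ∩ T) := by
  have hs : MeasurableSet {p : Ω × Plane | p.2 ∈ freeRegion r (fun j => U j p.1) ∧ p.2 ∈ T} :=
    (measurableSet_mem_freeRegion r measurable_snd fun j => (hU j).comp measurable_fst).inter
      (measurable_snd hT)
  exact (measurable_measure_prodMk_left hs).ennreal_toReal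

theorem abs_exp_neg_sub_exp_neg_le {a b : ℝ} (ha : 0 ≤ a) (hb : 0 ≤ b) :
    |Real.exp (-a) - Real.exp (-b)| ≤ |a - b| := by
  have key : ∀ {a b : ℝ}, 0 ≤ a → a ≤ b →
      |Real.exp (-a) - Real.exp (-b)| ≤ |a - b| := by
    intro a b ha hab
    have h1 : Real.exp (-b) = Real.exp (-a) * Real.exp (-(b - a)) := by
      rw [← Real.exp_add]; ring_nf
    have h2 := Real.add_one_le_exp (-(b - a))
    have h3 : Real.exp (-a) ≤ 1 := Real.exp_le_one_iff.2 (by linarith)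
    have h4 : Real.exp (-(b - a)) ≤ 1 := Real.exp_le_one_iff.2 (by linarith)
    have h5 := Real.exp_pos (-a)
    rw [abs_of_nonneg (by nlinarith), abs_of_nonpos (by linarith)]
    nlinarith
  rcases le_total a b with h | h
  · exact key ha h
  · rw [abs_sub_comm, abs_sub_comm a]; exact key hb h

section Independent

variable {Ω : Type*} [MeasurableSpace Ω] {P : Measure Ω} [IsProbabilityMeasure P]
  {X U : ℕ → Ω → Plane} {lam : ℝ}

/-- Conditioning on the users: by independence the joint law is a product, so the probability is an
average, over a frozen user configuration, of a probability about the nodes alone. -/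
theorem real_independent_eq_integral (hX : ∀ i, Measurable (X i)) (hU : ∀ j, Measurable (U j))
    (hXU : IndepFun (fun ω i => X i ω) (fun ω j => U j ω) P)
    {E : Set ((ℕ → Plane) × (ℕ → Plane))} (hE : MeasurableSet E) :
    Integrable (fun ω' => P.real {ω | ((fun i => X i ω), (fun j => U j ω')) ∈ E}) P ∧
    P.real {ω | ((fun i => X i ω), (fun j => U j ω)) ∈ E} =
      ∫ ω', P.real {ω | ((fun i => X i ω), (fun j => U j ω')) ∈ E} ∂P := by
  have hXm : Measurable fun ω i => X i ω := measurable_pi_lambda _ hX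
  have hUm : Measurable fun ω j => U j ω := measurable_pi_lambda _ hU
  have hmeas : Measurable fun u => (P.map fun ω i => X i ω) ((fun x => (x, u)) ⁻¹' E) :=
    measurable_measure_prodMk_right hE
  have hslice : ∀ ω', (P.map fun ω i => X i ω) ((fun x => (x, fun j => U j ω')) ⁻¹' E) =
      P {ω | ((fun i => X i ω), (fun j => U j ω')) ∈ E} := fun ω' =>
    Measure.map_apply hXm (measurable_prodMk_right hE)
  have hmeas' : Measurable fun ω' => P {ω | ((fun i => X i ω), (fun j => U j ω')) ∈ E} := by
    simp_rw [← hslice]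
    exact hmeas.comp hUm
  refine ⟨Integrable.of_bound hmeas'.ennreal_toReal.aestronglyMeasurable 1
    (Eventually.of_forall fun ω' => ?_), ?_⟩
  · rw [Real.norm_eq_abs]
    rw [abs_of_nonneg measureReal_nonneg]
    exact measureReal_le_one
  · have hprod := (indepFun_iff_map_prod_eq_prod_map_map hXm.aemeasurable hUm.aemeasurable).1 hXU
    have : P {ω | ((fun i => X i ω), (fun j => U j ω)) ∈ E} =
        ∫⁻ ω', P {ω | ((fun i => X i ω), (fun j => U j ω')) ∈ E} ∂P := by
      have h1 : P {ω | ((fun i => X i ω), (fun j => U j ω)) ∈ E} =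
          (P.map fun ω => ((fun i => X i ω), (fun j => U j ω))) E :=
        (Measure.map_apply (hXm.prodMk hUm) hE).symm
      have := Measure.isProbabilityMeasure_map (μ := P) hXm.aemeasurable
      have := Measure.isProbabilityMeasure_map (μ := P) hUm.aemeasurable
      rw [h1, hprod, Measure.prod_apply_symm hE, lintegral_map hmeas hUm]
      exact lintegral_congr hslice
    simp only [measureReal_def]
    rw [this, integral_toReal hmeas'.aemeasurable (Eventually.of_forall fun _ => measure_lt_top _ _)]

theorem integrable_abs_volume_freeRegion_sub (hU : ∀ j, Measurable (U j)) (r : ℝ) {T : Set Plane}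
    (hT : MeasurableSet T) (hVT : volume T ≠ ⊤) (lam μ : ℝ) :
    Integrable (fun ω => |lam * volume.real (freeRegion r (fun j => U j ω) ∩ T) - μ|) P := by
  have hm := measurable_volume_freeRegion_inter r hU hT
  refine (Integrable.sub ?_ (integrable_const μ)).abs
  refine Integrable.const_mul (Integrable.of_bound hm.aestronglyMeasurable (volume.real T)
    (Eventually.of_forall fun ω => ?_)) lam
  rw [Real.norm_of_nonneg measureReal_nonneg]
  exact measureReal_mono inter_subset_right hVT

/-- Having no free point in `C` is almost independent of the number of the free points in a set
disjoint from `C` if the area of the free part of `C` is almost deterministic. -/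
theorem abs_real_freeCount_lt_inter_sub_le (hX : IsPoissonPointProcess P X lam) (hl : 0 < lam)
    (hU : ∀ j, Measurable (U j)) (hXU : IndepFun (fun ω i => X i ω) (fun ω j => U j ω) P)
    (r : ℝ) {B C : Set Plane} (hB : MeasurableSet B) (hC : MeasurableSet C) (hVC : volume C ≠ ⊤)
    (hBC : Disjoint B C) (n : ℕ) {μ : ℝ} (hμ : 0 ≤ μ) :
    |P.real {ω | freeCount r (fun i => X i ω) (fun j => U j ω) B < n ∧
          freeCount r (fun i => X i ω) (fun j => U j ω) C = 0} -
        Real.exp (-μ) * P.real {ω | freeCount r (fun i => X i ω) (fun j => U j ω) B < n}| ≤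
      ∫ ω, |lam * volume.real (freeRegion r (fun j => U j ω) ∩ C) - μ| ∂P := by
  have hEB : MeasurableSet {q : (ℕ → Plane) × (ℕ → Plane) | freeCount r q.1 q.2 B < n} :=
    measurable_freeCount r hB (MeasurableSet.of_discrete (s := Iio (n : ℕ∞)))
  have hEC : MeasurableSet {q : (ℕ → Plane) × (ℕ → Plane) | freeCount r q.1 q.2 C = 0} :=
    measurable_freeCount r hC (measurableSet_singleton 0)
  obtain ⟨i1, e1⟩ := real_independent_eq_integral hX.measurable_point hU hXU (hEB.inter hEC)
  obtain ⟨i2, e2⟩ := real_independent_eq_integral hX.measurable_point hU hXU hEB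
  have e1' : P.real {ω | freeCount r (fun i => X i ω) (fun j => U j ω) B < n ∧
      freeCount r (fun i => X i ω) (fun j => U j ω) C = 0} = _ := e1
  have e2' : P.real {ω | freeCount r (fun i => X i ω) (fun j => U j ω) B < n} = _ := e2
  rw [e1', e2', ← integral_const_mul, ← integral_sub i1 (i2.const_mul _), ← Real.norm_eq_abs]
  refine norm_integral_le_of_norm_le (integrable_abs_volume_freeRegion_sub hU r hC hVC lam μ)
    (Eventually.of_forall fun ω' => ?_)
  have hD := measurableSet_freeRegion r fun j => U j ω'
  -- With the users frozen, the free parts of `B` and `C` are fixed disjoint sets and independence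
  -- is exact. The only error is replacing the mean on the free part of `C` by `μ`.
  have key := hX.real_count_lt_inter_count_eq_zero hl (hD.inter hB) (hD.inter hC)
    (measure_ne_top_of_subset inter_subset_right hVC)
    (hBC.mono inter_subset_right inter_subset_right) n
  have key' : P.real {ω | ((fun i => X i ω), (fun j => U j ω')) ∈
      {q : (ℕ → Plane) × (ℕ → Plane) | freeCount r q.1 q.2 B < n} ∩
        {q : (ℕ → Plane) × (ℕ → Plane) | freeCount r q.1 q.2 C = 0}} =
      P.real {ω | ((fun i => X i ω), (fun j => U j ω')) ∈
        {q : (ℕ → Plane) × (ℕ → Plane) | freeCount r q.1 q.2 B < n}} *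
        Real.exp (-(lam * volume.real (freeRegion r (fun j => U j ω') ∩ C))) := key
  rw [key', mul_comm, ← sub_mul, norm_mul, Real.norm_eq_abs, Real.norm_of_nonneg measureReal_nonneg]
  calc _ ≤ |Real.exp (-(lam * volume.real (freeRegion r (fun j => U j ω') ∩ C))) - Real.exp (-μ)| * 1 :=
        mul_le_mul_of_nonneg_left measureReal_le_one (abs_nonneg _)
    _ ≤ _ := by
      rw [mul_one]
      exact abs_exp_neg_sub_exp_neg_le (by positivity) hμ

/-- For frozen users this is the Poisson tail bound with a random mean. Since exp(-·) is 1-Lipschitz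
on the nonnegative reals, replacing that mean by `μ` costs at most their distance. -/
theorem real_freeCount_lt_le (hX : IsPoissonPointProcess P X lam) (hl : 0 < lam)
    (hU : ∀ j, Measurable (U j)) (hXU : IndepFun (fun ω i => X i ω) (fun ω j => U j ω) P)
    (r : ℝ) {T : Set Plane} (hT : MeasurableSet T) (hVT : volume T ≠ ⊤) (n : ℕ) {μ : ℝ}
    (hμ : 0 ≤ μ) :
    P.real {ω | freeCount r (fun i => X i ω) (fun j => U j ω) T < n} ≤
      2 ^ n * (Real.exp (-(μ / 2)) +
        ∫ ω, |lam * volume.real (freeRegion r (fun j => U j ω) ∩ T) - μ| ∂P) := by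
  have hE : MeasurableSet {q : (ℕ → Plane) × (ℕ → Plane) | freeCount r q.1 q.2 T < n} :=
    measurable_freeCount r hT (MeasurableSet.of_discrete (s := Iio (n : ℕ∞)))
  obtain ⟨i1, e1⟩ := real_independent_eq_integral hX.measurable_point hU hXU hE
  have e1' : P.real {ω | freeCount r (fun i => X i ω) (fun j => U j ω) T < n} = _ := e1
  have hi : Integrable (fun ω => |lam * volume.real (freeRegion r (fun j => U j ω) ∩ T) - μ|) P :=
    integrable_abs_volume_freeRegion_sub hU r hT hVT lam μ
  have hi2 : Integrable (fun ω => Real.exp (-(μ / 2)) +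
      |lam * volume.real (freeRegion r (fun j => U j ω) ∩ T) - μ|) P := (integrable_const _).add hi
  have h2 : Real.exp (-(μ / 2)) +
        ∫ ω, |lam * volume.real (freeRegion r (fun j => U j ω) ∩ T) - μ| ∂P =
      ∫ ω, (Real.exp (-(μ / 2)) +
        |lam * volume.real (freeRegion r (fun j => U j ω) ∩ T) - μ|) ∂P := by
    rw [integral_add (integrable_const _) hi]; simp
  rw [e1', h2, ← integral_const_mul]
  refine integral_mono i1 (hi2.const_mul _) fun ω' => ?_
  have hD := measurableSet_freeRegion r fun j => U j ω'
  have key := hX.real_count_lt_le hl (hD.inter hT)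
    (measure_ne_top_of_subset inter_subset_right hVT) n
  refine le_trans key ?_
  have h3 := abs_exp_neg_sub_exp_neg_le
    (a := lam * volume.real (freeRegion r (fun j => U j ω') ∩ T) / 2) (b := μ / 2)
    (by positivity) (by positivity)
  have h4 := (abs_le.1 h3).2
  have h5 : |lam * volume.real (freeRegion r (fun j => U j ω') ∩ T) / 2 - μ / 2| ≤
      |lam * volume.real (freeRegion r (fun j => U j ω') ∩ T) - μ| := by
    rw [← sub_div, abs_div, abs_two]
    exact div_le_self (abs_nonneg _) one_le_two
  simp only
  rw [neg_div]
  gcongr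
  linarith

end Independent

/-! ### Up-crossings of paths with locally finite level sets -/

theorem mem_upCrossingSet_iff {S : ℝ → ℝ} {δ t : ℝ} :
    t ∈ upCrossingSet S δ ↔
      0 < t ∧ (∀ᶠ s in 𝓝[<] t, S s < δ) ∧ ∀ᶠ s in 𝓝[>] t, δ ≤ S s := by
  refine and_congr_right fun _ => ⟨?_, ?_⟩
  · rintro ⟨ε, hε, h1, h2⟩
    exact ⟨mem_of_superset (Ioo_mem_nhdsLT (by linarith)) h1,
      mem_of_superset (Ioo_mem_nhdsGT (by linarith)) h2⟩
  · rintro ⟨h1, h2⟩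
    obtain ⟨l, hl, h1⟩ := mem_nhdsLT_iff_exists_Ioo_subset.1 h1
    obtain ⟨m, hm, h2⟩ := mem_nhdsGT_iff_exists_Ioo_subset.1 h2
    simp only [mem_Iio, mem_Ioi] at hl hm
    refine ⟨min (t - l) (m - t), lt_min (by linarith) (by linarith), fun s hs => h1 ?_,
      fun s hs => h2 ?_⟩
    · exact ⟨by linarith [hs.1, min_le_left (t - l) (m - t)], hs.2⟩
    · exact ⟨hs.1, by linarith [hs.2, min_le_right (t - l) (m - t)]⟩

/-- If `J` accumulates at t from the right, convexity fills a whole right neighbourhood. -/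
theorem Set.OrdConnected.eventually_nhdsGT {J : Set ℝ} (hJ : J.OrdConnected) (t : ℝ) :
    (∀ᶠ s in 𝓝[>] t, s ∈ J) ∨ ∀ᶠ s in 𝓝[>] t, s ∉ J := by
  by_cases h : ∃ᶠ s in 𝓝[>] t, s ∈ J
  · left
    obtain ⟨s₀, hs₀, ht₀⟩ := (h.and_eventually self_mem_nhdsWithin).exists
    filter_upwards [Ioo_mem_nhdsGT ht₀] with s hs
    obtain ⟨s₁, hs₁, ht₁⟩ := (h.and_eventually (Ioo_mem_nhdsGT hs.1)).exists
    exact hJ.out hs₁ hs₀ ⟨ht₁.2.le, hs.2.le⟩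
  · exact Or.inr (not_frequently.1 h)

theorem Set.OrdConnected.eventually_nhdsLT {J : Set ℝ} (hJ : J.OrdConnected) (t : ℝ) :
    (∀ᶠ s in 𝓝[<] t, s ∈ J) ∨ ∀ᶠ s in 𝓝[<] t, s ∉ J := by
  by_cases h : ∃ᶠ s in 𝓝[<] t, s ∈ J
  · left
    obtain ⟨s₀, hs₀, ht₀⟩ := (h.and_eventually self_mem_nhdsWithin).exists
    filter_upwards [Ioo_mem_nhdsLT ht₀] with s hs
    obtain ⟨s₁, hs₁, ht₁⟩ := (h.and_eventually (Ioo_mem_nhdsLT hs.2)).exists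
    exact hJ.out hs₀ hs₁ ⟨hs.1.le, ht₁.1.le⟩
  · exact Or.inr (not_frequently.1 h)

theorem eventually_exists_or_eventually_not_of_finite {ι : Type*} {l : Filter ℝ} {J : ι → Set ℝ}
    {F : Set ι} (hF : F.Finite)
    (h : ∀ i ∈ F, (∀ᶠ s in l, s ∈ J i) ∨ ∀ᶠ s in l, s ∉ J i) :
    (∀ᶠ s in l, ∃ i ∈ F, s ∈ J i) ∨ ∀ᶠ s in l, ¬∃ i ∈ F, s ∈ J i := by
  by_cases h0 : ∃ i ∈ F, ∀ᶠ s in l, s ∈ J i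
  · obtain ⟨i, hi, hs⟩ := h0
    exact Or.inl (hs.mono fun s hs => ⟨i, hi, hs⟩)
  · push Not at h0
    refine Or.inr ?_
    have : ∀ i ∈ F, ∀ᶠ s in l, s ∉ J i := fun i hi =>
      (h i hi).resolve_left (not_eventually.2 (h0 i hi))
    filter_upwards [(eventually_all_finite hF).2 this] with s hs
    push Not
    exact hs

/-- The path `S` exceeds the level `δ` on a locally finite union of intervals. -/
structure HasLocallyFiniteLevelSet {ι : Type*} (S : ℝ → ℝ) (δ : ℝ) (J : ι → Set ℝ) : Prop where
  ordConnected : ∀ i, (J i).OrdConnected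
  exists_finite : ∀ T : ℝ, ∃ F : Set ι, F.Finite ∧ ∀ t, |t| < T → (δ ≤ S t ↔ ∃ i ∈ F, t ∈ J i)

namespace HasLocallyFiniteLevelSet

variable {ι : Type*} {S : ℝ → ℝ} {δ : ℝ} {J : ι → Set ℝ}

theorem eventually_nhdsGT (h : HasLocallyFiniteLevelSet S δ J) (t : ℝ) :
    (∀ᶠ s in 𝓝[>] t, δ ≤ S s) ∨ ∀ᶠ s in 𝓝[>] t, S s < δ := by
  obtain ⟨F, hF, hS⟩ := h.exists_finite (|t| + 1)
  have hev : ∀ᶠ s in 𝓝[>] t, |s| < |t| + 1 := by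
    refine (continuous_abs.continuousWithinAt (s := Ioi t) (x := t)).eventually_lt_const ?_
    linarith
  refine (eventually_exists_or_eventually_not_of_finite hF
    fun i _ => (h.ordConnected i).eventually_nhdsGT t).imp ?_ ?_
  · intro h1; filter_upwards [h1, hev] with s h1 h2 using (hS s h2).2 h1
  · intro h1; filter_upwards [h1, hev] with s h1 h2 using not_le.1 fun h3 => h1 ((hS s h2).1 h3)

theorem eventually_nhdsLT (h : HasLocallyFiniteLevelSet S δ J) (t : ℝ) :
    (∀ᶠ s in 𝓝[<] t, δ ≤ S s) ∨ ∀ᶠ s in 𝓝[<] t, S s < δ := by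
  obtain ⟨F, hF, hS⟩ := h.exists_finite (|t| + 1)
  have hev : ∀ᶠ s in 𝓝[<] t, |s| < |t| + 1 := by
    refine (continuous_abs.continuousWithinAt (s := Iio t) (x := t)).eventually_lt_const ?_
    linarith
  refine (eventually_exists_or_eventually_not_of_finite hF
    fun i _ => (h.ordConnected i).eventually_nhdsLT t).imp ?_ ?_
  · intro h1; filter_upwards [h1, hev] with s h1 h2 using (hS s h2).2 h1
  · intro h1; filter_upwards [h1, hev] with s h1 h2 using not_le.1 fun h3 => h1 ((hS s h2).1 h3)

/-- Each up-crossing up to T is the greatest lower bound of one of finitely many intervals, and each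
interval has at most one. -/
theorem finite_upCrossingSet_inter_Iic (h : HasLocallyFiniteLevelSet S δ J) (T : ℝ) :
    (upCrossingSet S δ ∩ Iic T).Finite := by
  obtain ⟨F, hF, hS⟩ := h.exists_finite (|T| + 1)
  refine (hF.biUnion (t := fun i => {t | IsGLB (J i) t}) fun i _ =>
    (show ({t | IsGLB (J i) t} : Set ℝ).Subsingleton from
      fun a ha c hc => ha.unique hc).finite).subset ?_
  rintro t ⟨ht, htT⟩
  obtain ⟨ht0, h1, h2⟩ := mem_upCrossingSet_iff.1 ht
  have habs : |t| < |T| + 1 := by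
    rw [abs_of_pos ht0]; exact (le_trans htT (le_abs_self T)).trans_lt (by linarith)
  have hev : ∀ᶠ s in 𝓝 t, |s| < |T| + 1 := continuous_abs.continuousAt.eventually_lt_const habs
  have hex : ∃ i ∈ F, ∃ᶠ s in 𝓝[>] t, s ∈ J i := by
    by_contra! hcon
    obtain ⟨s, hs1, hs2, hs3⟩ := ((eventually_all_finite hF).2 hcon).and
      (h2.and (hev.filter_mono nhdsWithin_le_nhds)) |>.exists
    obtain ⟨i, hi, hsi⟩ := (hS s hs3).1 hs2
    exact hs1 i hi hsi
  obtain ⟨i, hi, hfr⟩ := hex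
  refine mem_biUnion hi ⟨fun s hs => ?_, fun c hc => ?_⟩
  -- A point of `J i` to the left of t, joined by convexity to points right of t, would force the
  -- path to be high just before t.
  · by_contra! hst
    obtain ⟨s₁, hs₁, ht₁⟩ := (hfr.and_eventually self_mem_nhdsWithin).exists
    obtain ⟨s₂, hs₂, hs₃, hs₄⟩ := (h1.and ((hev.filter_mono nhdsWithin_le_nhds).and
      (Ioo_mem_nhdsLT hst))).exists
    have : s₂ ∈ J i := (h.ordConnected i).out hs hs₁ ⟨hs₄.1.le, hs₄.2.le.trans (le_of_lt ht₁)⟩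
    exact absurd ((hS s₂ hs₃).2 ⟨i, hi, this⟩) (not_le.2 hs₂)
  · by_contra! hct
    obtain ⟨s₁, hs₁, ht₁⟩ := (hfr.and_eventually (Ioo_mem_nhdsGT hct)).exists
    exact absurd (hc hs₁) (not_le.2 ht₁.2)

/-- Beyond any T there is a low time followed by a high one. Local finiteness forces the path to be
eventually low or eventually high on each side of every time, so it cannot pass from one to the
other without an up-crossing. -/
theorem infinite_upCrossingSet (h : HasLocallyFiniteLevelSet S δ J)
    (hlow : ∀ T : ℝ, ∃ t > T, ∀ᶠ s in 𝓝 t, S s < δ)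
    (hhigh : ∀ T : ℝ, ∃ t > T, ∀ᶠ s in 𝓝 t, δ ≤ S s) : (upCrossingSet S δ).Infinite := by
  refine infinite_of_forall_exists_gt fun T => ?_
  obtain ⟨t₀, ht₀, h₀⟩ := hlow (max T 0)
  obtain ⟨t₁, ht₁, h₁⟩ := hhigh t₀
  -- The up-crossing is the supremum of the times between the low and the high time just before
  -- which the path is low.
  set Q : Set ℝ := {t | t ∈ Icc t₀ t₁ ∧ ∀ᶠ s in 𝓝[<] t, S s < δ}
  have hQ₀ : t₀ ∈ Q := ⟨⟨le_rfl, ht₁.le⟩, h₀.filter_mono nhdsWithin_le_nhds⟩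
  have hbdd : BddAbove Q := ⟨t₁, fun t ht => ht.1.2⟩
  set q := sSup Q
  have hq₀ : t₀ ≤ q := le_csSup hbdd hQ₀
  have hq₁ : q ≤ t₁ := csSup_le ⟨t₀, hQ₀⟩ fun t ht => ht.1.2
  have hleft : ∀ᶠ s in 𝓝[<] q, S s < δ := by
    refine (h.eventually_nhdsLT q).resolve_left fun hcon => ?_
    obtain ⟨a, ha, hA⟩ := mem_nhdsLT_iff_exists_Ioo_subset.1 hcon
    obtain ⟨c, hcQ, hac⟩ := exists_lt_of_lt_csSup ⟨t₀, hQ₀⟩ (show a < q from ha)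
    obtain ⟨s, hs1, hs2⟩ := (hcQ.2.and (Ioo_mem_nhdsLT hac)).exists
    exact absurd (hA ⟨hs2.1, hs2.2.trans_le (le_csSup hbdd hcQ)⟩) (not_le.2 hs1)
  have hne : q < t₁ := by
    refine lt_of_le_of_ne hq₁ fun heq => ?_
    rw [heq] at hleft
    obtain ⟨s, hs1, hs2⟩ := (hleft.and (h₁.filter_mono nhdsWithin_le_nhds)).exists
    exact absurd hs2 (not_le.2 hs1)
  refine ⟨q, mem_upCrossingSet_iff.2 ⟨?_, hleft, ?_⟩, ?_⟩
  · exact ((le_max_right T 0).trans_lt ht₀).trans_le hq₀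
  · refine (h.eventually_nhdsGT q).resolve_right fun hcon => ?_
    obtain ⟨c, hc, hC⟩ := mem_nhdsGT_iff_exists_Ioo_subset.1 hcon
    obtain ⟨c', hqc', hc'⟩ := exists_between (lt_min (show q < c from hc) hne)
    have : c' ∈ Q := by
      refine ⟨⟨by linarith, (hc'.trans_le (min_le_right _ _)).le⟩, ?_⟩
      filter_upwards [Ioo_mem_nhdsLT hqc'] with s hs
      exact hC ⟨hs.1, hs.2.trans (hc'.trans_le (min_le_left _ _))⟩
    exact absurd (le_csSup hbdd this) (not_le.2 hqc')
  · exact ((le_max_left T 0).trans_lt ht₀).trans_le hq₀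

end HasLocallyFiniteLevelSet

/-- Local finiteness makes the counting function right-continuous, so the infimum defining the n-th
time is attained. This translates statements about times into statements about counts. -/
theorem nthUpCrossing_le_iff {S : ℝ → ℝ} {δ : ℝ} (hinf : (upCrossingSet S δ).Infinite)
    (hfin : ∀ t, (upCrossingSet S δ ∩ Iic t).Finite) {n : ℕ} {t : ℝ} (ht : 0 ≤ t) :
    nthUpCrossing S δ n ≤ t ↔ (n : ℕ∞) ≤ (upCrossingSet S δ ∩ Iic t).encard := by
  set W := upCrossingSet S δ
  set Q : Set ℝ := {t | 0 ≤ t ∧ (n : ℕ∞) ≤ (W ∩ Iic t).encard}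
  have hQ : nthUpCrossing S δ n = sInf Q := rfl
  have hbdd : BddBelow Q := ⟨0, fun s hs => hs.1⟩
  have hne : Q.Nonempty := by
    obtain ⟨F, hFW, hF⟩ := hinf.exists_subset_card_eq n
    obtain ⟨c, hc⟩ := F.bddAbove
    refine ⟨max c 0, le_max_right _ _, ?_⟩
    rw [← hF, ← encard_coe_eq_coe_finsetCard]
    exact encard_le_encard fun s hs => ⟨hFW hs, (hc hs).trans (le_max_left _ _)⟩
  rw [hQ]
  refine ⟨fun h => ?_, fun h => csInf_le hbdd ⟨ht, h⟩⟩
  set T := sInf Q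
  have hT : (n : ℕ∞) ≤ (W ∩ Iic T).encard := by
    have hopen : ∀ᶠ s in 𝓝[≥] T, W ∩ Iic s ⊆ W ∩ Iic T := by
      have hfin' : ((W ∩ Iic (T + 1)) \ Iic T).Finite := (hfin (T + 1)).sdiff
      have h1 : ∀ᶠ s in 𝓝[≥] T, ∀ a ∈ (W ∩ Iic (T + 1)) \ Iic T, s < a := by
        refine (eventually_all_finite hfin').2 fun a ha => ?_
        exact (Iio_mem_nhds (not_le.1 ha.2) |> mem_nhdsWithin_of_mem_nhds)
      have h2 : ∀ᶠ s in 𝓝[≥] T, s < T + 1 :=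
        mem_nhdsWithin_of_mem_nhds (Iio_mem_nhds (by linarith))
      filter_upwards [h1, h2] with s h1 h2 a ha
      refine ⟨ha.1, ?_⟩
      by_contra hcon
      exact absurd (h1 a ⟨⟨ha.1, ha.2.trans h2.le⟩, hcon⟩) (not_lt.2 ha.2)
    obtain ⟨c, hc, hsub⟩ := mem_nhdsGE_iff_exists_Ico_subset.1 hopen
    obtain ⟨q, hqQ, hq⟩ := exists_lt_of_csInf_lt hne (show T < c from hc)
    exact hqQ.2.trans (encard_le_encard (hsub ⟨csInf_le hbdd hqQ, hq⟩))
  exact hT.trans (encard_le_encard fun a ha => ⟨ha.1, ha.2.trans h⟩)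

/-! ### The shared rate along a fixed configuration -/

/-- Every bounded region contains finitely many points of the configuration. -/
def IsLocallyFiniteConfig (x : ℕ → Plane) : Prop :=
  ∀ (y : Plane) (R : ℝ), {i | x i ∈ Metric.closedBall y R}.Finite

theorem IsLocallyFiniteConfig.mem_voronoiCell_closestIndex {x : ℕ → Plane}
    (hx : IsLocallyFiniteConfig x) (y : Plane) : y ∈ voronoiCell x (closestIndex x y) := by
  have hne : {i | y ∈ voronoiCell x i}.Nonempty := by
    -- Only the finitely many nodes no farther than node 0 compete.
    obtain ⟨i, hi, hmin⟩ := exists_min_image {i | x i ∈ Metric.closedBall y (dist y (x 0))}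
      (fun i => dist y (x i)) (hx y _) ⟨0, by simp [dist_comm]⟩
    refine ⟨i, fun j => ?_⟩
    by_cases hj : x j ∈ Metric.closedBall y (dist y (x 0))
    · exact hmin j hj
    · rw [Metric.mem_closedBall, not_le, dist_comm (x j)] at hj
      have h0 := hmin 0 (by simp [dist_comm])
      exact h0.trans hj.le
  exact Nat.sInf_mem hne

theorem closestIndex_eq_iff {x : ℕ → Plane} (hx : IsLocallyFiniteConfig x) (y : Plane) (i : ℕ) :
    closestIndex x y = i ↔
      (∀ j, dist y (x i) ≤ dist y (x j)) ∧ ∀ j < i, dist y (x i) < dist y (x j) := by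
  constructor
  · rintro rfl
    have h := hx.mem_voronoiCell_closestIndex y
    refine ⟨h, fun j hj => ?_⟩
    by_contra! hcon
    exact Nat.notMem_of_lt_sInf hj (show y ∈ voronoiCell x j from fun k => hcon.trans (h k))
  · rintro ⟨h1, h2⟩
    refine le_antisymm (Nat.sInf_le h1) ?_
    by_contra! hcon
    exact absurd (hx.mem_voronoiCell_closestIndex y i) (not_le.2 (h2 _ hcon))

theorem affine_nonpos_of_mem_Icc {α c s t u : ℝ} (h : t ∈ Icc s u) (hs : α * s ≤ c)
    (hu : α * u ≤ c) : α * t ≤ c := by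
  rcases le_total 0 α with h0 | h0
  · nlinarith [h.2]
  · nlinarith [h.1]

theorem affine_neg_of_mem_Icc {α c s t u : ℝ} (h : t ∈ Icc s u) (hs : α * s < c)
    (hu : α * u < c) : α * t < c := by
  rcases le_total 0 α with h0 | h0
  · nlinarith [h.2]
  · nlinarith [h.1]

namespace NetworkParams

variable {M : NetworkParams} {b : OrthonormalBasis (Fin 2) ℝ Plane} {x u : ℕ → Plane}

theorem dist_position_le_of_mem_Icc (hb : b 0 = M.dir) {y : Plane} {R s t w : ℝ}
    (h : t ∈ Icc s w) (hs : dist (M.position s) y ≤ R) (hw : dist (M.position w) y ≤ R) :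
    dist (M.position t) y ≤ R := by
  have hR : 0 ≤ R := dist_nonneg.trans hs
  rw [← abs_of_nonneg hR, ← abs_of_nonneg (dist_nonneg (x := M.position _) (y := y)),
    ← sq_le_sq, M.dist_position_sq hb] at hs hw ⊢
  obtain ⟨h1, h2⟩ := h
  have key : ∀ p q r : ℝ, p ≤ q → q ≤ r → q ^ 2 ≤ max (p ^ 2) (r ^ 2) := by
    intro p q r hp hr
    rcases le_total 0 q with h0 | h0
    · exact le_max_of_le_right (by nlinarith)
    · exact le_max_of_le_left (by nlinarith)
  rcases le_total 0 M.v with h0 | h0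
  · have := key (M.v * s - b.repr y 0) (M.v * t - b.repr y 0) (M.v * w - b.repr y 0)
      (by nlinarith) (by nlinarith)
    rcases le_max_iff.1 this with h | h <;> linarith
  · have := key (M.v * w - b.repr y 0) (M.v * t - b.repr y 0) (M.v * s - b.repr y 0)
      (by nlinarith) (by nlinarith)
    rcases le_max_iff.1 this with h | h <;> linarith

theorem dist_position_le_dist_iff (hb : b 0 = M.dir) (t : ℝ) (y z : Plane) :
    dist (M.position t) y ≤ dist (M.position t) z ↔
      (2 * M.v * (b.repr z 0 - b.repr y 0)) * t ≤
        b.repr z 0 ^ 2 + b.repr z 1 ^ 2 - b.repr y 0 ^ 2 - b.repr y 1 ^ 2 := by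
  rw [← abs_of_nonneg (dist_nonneg (x := M.position t) (y := y)),
    ← abs_of_nonneg (dist_nonneg (x := M.position t) (y := z)),
    ← sq_le_sq, M.dist_position_sq hb, M.dist_position_sq hb]
  constructor <;> intro h <;> nlinarith

/-- When squared distances to two nodes are compared along the line, the terms quadratic in t
cancel. Closest-node conditions thus become affine inequalities in t, strict ones for smaller
indices because of the tie rule, and both kinds are convex. -/
theorem ordConnected_closestIndex_eq (hb : b 0 = M.dir) (hx : IsLocallyFiniteConfig x) (i : ℕ) :
    {t | closestIndex x (M.position t) = i}.OrdConnected := by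
  refine ⟨fun s hs w hw t ht => ?_⟩
  simp only [mem_ofPred_eq, closestIndex_eq_iff hx, ← not_le (b := dist _ (x i)),
    dist_position_le_dist_iff hb] at hs hw ⊢
  refine ⟨fun j => affine_nonpos_of_mem_Icc ht (hs.1 j) (hw.1 j), fun j hj => ?_⟩
  have h1 := not_le.1 (hs.2 j hj)
  have h2 := not_le.1 (hw.2 j hj)
  refine not_le.2 ?_
  have := affine_neg_of_mem_Icc (α := -(2 * M.v * (b.repr (x i) 0 - b.repr (x j) 0)))
    (c := -(b.repr (x i) 0 ^ 2 + b.repr (x i) 1 ^ 2 - b.repr (x j) 0 ^ 2 - b.repr (x j) 1 ^ 2))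
    ht (by linarith) (by linarith)
  linarith

/-- Positivity of `L` is essential: `0 ^ (-M.beta)` is 0 by convention, so the rate would vanish at
a node instead of blowing up. This is why nodes on the line must be excluded later. -/
theorem le_log_snr_iff (hM : M.Admissible) {δ L : ℝ} (hδ : 0 < δ) (hL : 0 < L) :
    δ ≤ M.a * Real.log (1 + M.p * L ^ (-M.beta) / M.w) ↔ L ≤ M.rateRadius δ := by
  have hp := hM.p_pos
  have hw := hM.w_pos
  have ha := hM.a_pos
  have hβ : 0 < M.beta := by linarith [hM.two_lt_beta]
  have hE : 0 < Real.exp (δ / M.a) - 1 := by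
    have := Real.add_one_le_exp (δ / M.a)
    have : 0 < δ / M.a := by positivity
    linarith
  have hLβ : 0 < L ^ M.beta := Real.rpow_pos_of_pos hL _
  rw [← div_le_iff₀' ha, Real.le_log_iff_exp_le (by positivity), ← sub_le_iff_le_add',
    NetworkParams.rateRadius, NetworkParams.coverageRadius, one_div,
    Real.le_rpow_inv_iff_of_pos hL.le (by positivity) hβ, Real.rpow_neg hL.le,
    le_div_iff₀ hw, ← div_eq_mul_inv, le_div_iff₀ hLβ, le_div_iff₀ (by positivity)]
  constructor <;> intro h <;> linarith

theorem rateRadius_pos (hM : M.Admissible) {δ : ℝ} (hδ : 0 < δ) : 0 < M.rateRadius δ := by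
  have hp := hM.p_pos
  have hw := hM.w_pos
  have h0 : 0 < δ / M.a := div_pos hδ hM.a_pos
  have hE : 0 < Real.exp (δ / M.a) - 1 := by linarith [Real.add_one_le_exp (δ / M.a)]
  exact Real.rpow_pos_of_pos (by positivity) _

theorem rateRadius_anti (hM : M.Admissible) {δ δ' : ℝ} (hδ : 0 < δ) (h : δ ≤ δ') :
    M.rateRadius δ' ≤ M.rateRadius δ := by
  have hp := hM.p_pos
  have hw := hM.w_pos
  have ha := hM.a_pos
  have h0 : 0 < δ / M.a := div_pos hδ ha
  have hE : 0 < Real.exp (δ / M.a) - 1 := by linarith [Real.add_one_le_exp (δ / M.a)]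
  have hE' : Real.exp (δ / M.a) ≤ Real.exp (δ' / M.a) := by gcongr
  have hβ : 0 ≤ 1 / M.beta := by have := hM.two_lt_beta; positivity
  refine Real.rpow_le_rpow (div_nonneg hp.le (by nlinarith)) ?_ hβ
  gcongr

theorem coverageRadius_pos (hM : M.Admissible) : 0 < M.coverageRadius M.gam :=
  Real.rpow_pos_of_pos (div_pos hM.p_pos (mul_pos hM.w_pos hM.gam_pos)) _

/-- The number of users in the disc of coverage of the node `i`. -/
noncomputable def nodeUsers (M : NetworkParams) (x u : ℕ → Plane) (i : ℕ) : ℕ :=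
  (pointCount u (Metric.closedBall (x i) (M.coverageRadius M.gam))).toNat

/-- Local finiteness of the users is needed because `toNat` also sends `⊤` to 0. -/
theorem nodeUsers_eq_zero_iff (hu : IsLocallyFiniteConfig u) (i : ℕ) :
    M.nodeUsers x u i = 0 ↔ x i ∈ freeRegion (M.coverageRadius M.gam) u := by
  rw [mem_freeRegion_iff_pointCount, nodeUsers, ENat.toNat_eq_zero]
  exact or_iff_left (encard_ne_top_iff.2 (hu _ _))

/-- The path is at least `δ` iff the closest node is close enough, given the number of its
users. -/
theorem le_lowerSharedRate_iff (hM : M.Admissible) (hx : IsLocallyFiniteConfig x) {δ t : ℝ}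
    (hδ : 0 < δ) {i : ℕ} (hi : closestIndex x (M.position t) = i)
    (hpos : 0 < dist (M.position t) (x i)) :
    δ ≤ M.lowerSharedRate x u t ↔ dist (M.position t) (x i) ≤ M.coverageRadius M.gam ∧
      dist (M.position t) (x i) ≤ M.rateRadius (δ * (M.nodeUsers x u i + 1)) := by
  have hv := hx.mem_voronoiCell_closestIndex (M.position t)
  rw [hi] at hv
  have hN : (0 : ℝ) < (M.nodeUsers x u i : ℝ) + 1 := by positivity
  by_cases hL : dist (M.position t) (x i) ≤ M.coverageRadius M.gam
  · have hU : M.upperSharingNumber x u t = M.nodeUsers x u i := by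
      rw [upperSharingNumber, hi, if_pos ⟨hv, hL⟩, closestNode, hi, nodeUsers]
    rw [lowerSharedRate, hU, shannonRate, distClosest, closestNode, hi, if_pos hL, snr,
      distClosest, closestNode, hi, mul_one_div, le_div_iff₀ hN,
      le_log_snr_iff hM (mul_pos hδ hN) hpos]
    exact ⟨fun h => ⟨hL, h⟩, fun h => h.2⟩
  · rw [lowerSharedRate, shannonRate, distClosest, closestNode, hi, if_neg hL, zero_mul]
    exact ⟨fun h => absurd h (not_le.2 hδ), fun h => absurd h.1 hL⟩

theorem dist_position_pos (hb : b 0 = M.dir) {y : Plane} (hy : b.repr y 1 ≠ 0) (t : ℝ) :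
    0 < dist (M.position t) y := by
  have h := M.dist_position_sq hb t y
  have : 0 < b.repr y 1 ^ 2 := by positivity
  by_contra! hcon
  have h0 : dist (M.position t) y = 0 := le_antisymm hcon dist_nonneg
  rw [h0] at h
  nlinarith [sq_nonneg (M.v * t - b.repr y 0)]

theorem dist_position_position (hM : M.Admissible) (s t : ℝ) :
    dist (M.position s) (M.position t) = M.v * |s - t| := by
  rw [position, position, dist_eq_norm, ← sub_smul, norm_smul, hM.norm_dir, mul_one, ← mul_sub,
    Real.norm_eq_abs, abs_mul, abs_of_pos hM.v_pos]

/-- The level set is split according to the closest node. While that node is fixed, so is its number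
of users, and each piece is the intersection of an interval of times with chords of discs. -/
theorem hasLocallyFiniteLevelSet_lowerSharedRate (hM : M.Admissible) (hb : b 0 = M.dir)
    (hx : IsLocallyFiniteConfig x) (hline : ∀ i, b.repr (x i) 1 ≠ 0) {δ : ℝ} (hδ : 0 < δ) :
    HasLocallyFiniteLevelSet (M.lowerSharedRate x u) δ
      fun i => {t | closestIndex x (M.position t) = i ∧ δ ≤ M.lowerSharedRate x u t} := by
  constructor
  · intro i
    refine ⟨fun s hs w hw t ht => ?_⟩
    have hti : closestIndex x (M.position t) = i :=
      (ordConnected_closestIndex_eq hb hx i).out hs.1 hw.1 ht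
    obtain ⟨hs1, hs2⟩ := hs
    obtain ⟨hw1, hw2⟩ := hw
    have hp := fun t => dist_position_pos hb (hline i) t
    rw [le_lowerSharedRate_iff hM hx hδ hs1 (hp s)] at hs2
    rw [le_lowerSharedRate_iff hM hx hδ hw1 (hp w)] at hw2
    refine ⟨hti, ?_⟩
    rw [le_lowerSharedRate_iff hM hx hδ hti (hp t)]
    exact ⟨dist_position_le_of_mem_Icc hb ht hs2.1 hw2.1,
      dist_position_le_of_mem_Icc hb ht hs2.2 hw2.2⟩
  · intro T
    -- Before time T a serving node is within the coverage radius of the path, hence in this ball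
    -- around the start.
    refine ⟨_, hx (M.position 0) (M.v * T + M.coverageRadius M.gam), fun t ht => ?_⟩
    refine ⟨fun h => ⟨_, ?_, rfl, h⟩, fun ⟨i, _, _, h⟩ => h⟩
    have h1 := ((le_lowerSharedRate_iff hM hx hδ rfl (dist_position_pos hb (hline _) t)).1 h).1
    rw [mem_ofPred_eq, Metric.mem_closedBall, dist_comm]
    have h2 := dist_triangle (M.position 0) (M.position t) (x (closestIndex x (M.position t)))
    rw [dist_position_position hM, zero_sub, abs_neg] at h2
    have h3 : M.v * |t| ≤ M.v * T := mul_le_mul_of_nonneg_left ht.le hM.v_pos.le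
    linarith

theorem continuous_position (M : NetworkParams) : Continuous M.position := by
  unfold position; fun_prop

/-- The path vanishes around the centre of a large disc without nodes. -/
theorem eventually_lowerSharedRate_lt {δ t R : ℝ} (hδ : 0 < δ)
    (hR : M.coverageRadius M.gam < R) (h : ∀ i, x i ∉ Metric.closedBall (M.position t) R) :
    ∀ᶠ s in 𝓝 t, M.lowerSharedRate x u s < δ := by
  have hcont : Tendsto (fun s => dist (M.position s) (M.position t)) (𝓝 t) (𝓝 0) := by
    have := (M.continuous_position.dist (continuous_const (y := M.position t))).tendsto t
    simpa using this
  filter_upwards [hcont.eventually_lt_const (show 0 < R - M.coverageRadius M.gam by linarith)] with s hs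
  have h1 := h (closestIndex x (M.position s))
  rw [Metric.mem_closedBall, not_le, dist_comm] at h1
  have h2 := dist_triangle (M.position t) (M.position s) (x (closestIndex x (M.position s)))
  rw [dist_comm (M.position t) (M.position s)] at h2
  rw [lowerSharedRate, shannonRate, distClosest, closestNode, if_neg (by linarith), zero_mul]
  exact hδ

/-- The path is at least `δ` near a node without users in a neighbourhood of its disc of
coverage. -/
theorem eventually_le_lowerSharedRate (hM : M.Admissible) (hb : b 0 = M.dir)
    (hx : IsLocallyFiniteConfig x) (hu : IsLocallyFiniteConfig u)
    (hline : ∀ i, b.repr (x i) 1 ≠ 0) {δ ε t : ℝ} (hδ : 0 < δ)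
    (hε : 2 * ε ≤ M.coverageRadius M.gam) (hε' : 2 * ε ≤ M.rateRadius δ) {i : ℕ}
    (hi : x i ∈ freeRegion (M.coverageRadius M.gam + 4 * ε) u)
    (hti : dist (M.position t) (x i) < 2 * ε) :
    ∀ᶠ s in 𝓝 t, δ ≤ M.lowerSharedRate x u s := by
  have hcont : Continuous fun s => dist (M.position s) (x i) :=
    M.continuous_position.dist continuous_const
  filter_upwards [hcont.continuousAt.eventually_lt_const hti] with s hs
  have hle := hx.mem_voronoiCell_closestIndex (M.position s) i
  rw [le_lowerSharedRate_iff hM hx hδ rfl (dist_position_pos hb (hline _) s)]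
  set j := closestIndex x (M.position s)
  -- The closest node `j` need not be `i`, but both are within 2ε of the user; the margin 4ε in the
  -- hypothesis on `i` therefore keeps `j` free.
  have hfree : x j ∈ freeRegion (M.coverageRadius M.gam) u := fun k => by
    have h1 := hi k
    have h2 := dist_triangle (x i) (x j) (u k)
    have h3 := dist_triangle_left (x i) (x j) (M.position s)
    linarith
  rw [(nodeUsers_eq_zero_iff hu j).2 hfree]
  simp only [Nat.cast_zero, zero_add, mul_one]
  constructor <;> linarith

end NetworkParams

/-! ### Up-crossings of sparse configurations -/

namespace NetworkParams

variable {M : NetworkParams} {b : OrthonormalBasis (Fin 2) ℝ Plane} {x u : ℕ → Plane}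

/-- The tube of radius `ρ` around the path of the mobile user, between the travelled distances
`s` and `ℓ`. -/
def pathTube (b : OrthonormalBasis (Fin 2) ℝ Plane) (s ℓ ρ : ℝ) : Set Plane :=
  coordBox b (Ioc s ℓ) (Ioo (-ρ) ρ)

/-- The nodes are in general position with respect to the path up to the distance `ℓ`, on the scale
of `ρ`, and none of them is within `ρ₂` of the path. -/
structure IsSparse (b : OrthonormalBasis (Fin 2) ℝ Plane) (x : ℕ → Plane) (ρ ρ₂ ℓ : ℝ) : Prop where
  notMem_narrow : ∀ i, x i ∉ coordBox b (Icc (-ρ) (ℓ + 2 * ρ)) (Icc (-ρ₂) ρ₂)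
  notMem_start : ∀ i, x i ∉ coordBox b (Icc (-ρ) ρ) (Icc (-ρ) ρ)
  notMem_end : ∀ i, x i ∉ coordBox b (Icc (ℓ - 2 * ρ) (ℓ + 2 * ρ)) (Icc (-ρ) ρ)
  separated : ∀ i j, i ≠ j → x i ∈ pathTube b 0 ℓ ρ → 2 * ρ < dist (x i) (x j)
  coord_ne_zero : ∀ i, b.repr (x i) 1 ≠ 0
  coord_ne : ∀ i, |b.repr (x i) 1| ≠ ρ

theorem dist_position_le_iff (hb : b 0 = M.dir) {ρ : ℝ} (hρ : 0 ≤ ρ) (t : ℝ) {y : Plane}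
    (hy : |b.repr y 1| < ρ) : dist (M.position t) y ≤ ρ ↔
      |M.v * t - b.repr y 0| ≤ √(ρ ^ 2 - b.repr y 1 ^ 2) := by
  have h1 : b.repr y 1 ^ 2 < ρ ^ 2 := by rwa [sq_lt_sq, abs_of_nonneg hρ]
  rw [← abs_of_nonneg hρ, ← abs_of_nonneg (dist_nonneg (x := M.position t) (y := y)),
    ← sq_le_sq, M.dist_position_sq hb, abs_of_nonneg hρ, Real.le_sqrt (abs_nonneg _), sq_abs]
  · exact ⟨fun h => by linarith, fun h => by linarith⟩
  · linarith

/-- Sparseness removes the interplay between nodes: a served node with users would have to lie in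
the excluded narrow strip, and a node of the tube within ρ of the user is automatically the closest
one. -/
theorem le_lowerSharedRate_iff_exists (hM : M.Admissible) (hb : b 0 = M.dir)
    (hx : IsLocallyFiniteConfig x) (hu : IsLocallyFiniteConfig u) {δ ℓ : ℝ} (hδ : 0 < δ)
    (hδr : M.rateRadius δ ≤ M.coverageRadius M.gam)
    (hs : IsSparse b x (M.rateRadius δ) (M.rateRadius (2 * δ)) ℓ) {t : ℝ} (ht0 : 0 ≤ M.v * t)
    (htℓ : M.v * t ≤ ℓ + M.rateRadius δ) :
    δ ≤ M.lowerSharedRate x u t ↔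
      ∃ i, x i ∈ freeRegion (M.coverageRadius M.gam) u ∩ pathTube b 0 ℓ (M.rateRadius δ) ∧
        dist (M.position t) (x i) ≤ M.rateRadius δ := by
  have hρ := rateRadius_pos hM hδ
  set ρ := M.rateRadius δ with hρdef
  constructor
  · intro h
    obtain ⟨h1, h2⟩ := (le_lowerSharedRate_iff hM hx hδ rfl
      (dist_position_pos hb (hs.coord_ne_zero _) t)).1 h
    set i := closestIndex x (M.position t)
    have hc0 := abs_coord_sub_le_dist b (M.position t) (x i) 0
    have hc1 := abs_coord_sub_le_dist b (M.position t) (x i) 1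
    rw [(M.coord_position hb t).1] at hc0
    rw [(M.coord_position hb t).2] at hc1
    have hN : M.nodeUsers x u i = 0 := by
      -- One user already raises the required unshared rate to at least 2δ, hence lowers the radius
      -- to `rateRadius (2 * δ)`.
      by_contra hN
      have hN1 : (1 : ℝ) ≤ M.nodeUsers x u i := by exact_mod_cast Nat.one_le_iff_ne_zero.2 hN
      have h3 : dist (M.position t) (x i) ≤ M.rateRadius (2 * δ) :=
        h2.trans (rateRadius_anti hM (by linarith) (by nlinarith))
      have h4 : M.rateRadius (2 * δ) ≤ ρ := rateRadius_anti hM hδ (by linarith)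
      have hc0' := abs_le.1 (hc0.trans h3)
      have hc1' := abs_le.1 (hc1.trans h3)
      exact hs.notMem_narrow i ⟨⟨by linarith, by linarith⟩, by linarith, by linarith⟩
    rw [hN] at h2
    simp only [Nat.cast_zero, zero_add, mul_one] at h2
    have hc0' := abs_le.1 (hc0.trans h2)
    have hc1' := abs_le.1 (hc1.trans h2)
    have hne := hs.coord_ne i
    have hlt : |b.repr (x i) 1| < ρ := lt_of_le_of_ne (abs_le.2 ⟨by linarith, by linarith⟩) hne
    have hI : b.repr (x i) 1 ∈ Icc (-ρ) ρ := ⟨by linarith, by linarith⟩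
    refine ⟨i, ⟨(nodeUsers_eq_zero_iff hu i).1 hN, ⟨?_, ?_⟩, abs_lt.1 hlt⟩, h2⟩
    · by_contra! hcon
      exact hs.notMem_start i ⟨⟨by linarith, by linarith⟩, hI⟩
    · by_contra! hcon
      exact hs.notMem_end i ⟨⟨by linarith, by linarith⟩, hI⟩
  · rintro ⟨i, ⟨hi1, hi2⟩, hi3⟩
    have hv := hx.mem_voronoiCell_closestIndex (M.position t)
    have hci : closestIndex x (M.position t) = i := by
      -- The true closest node would also be within ρ of the user, hence within 2ρ of node `i`,
      -- against separation.
      by_contra hne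
      have h1 := hs.separated i _ (Ne.symm hne) hi2
      have h2 := dist_triangle_left (x i) (x (closestIndex x (M.position t))) (M.position t)
      have h3 := hv i
      linarith
    rw [le_lowerSharedRate_iff hM hx hδ hci (dist_position_pos hb (hs.coord_ne_zero i) t),
      (nodeUsers_eq_zero_iff hu i).2 hi1]
    simp only [Nat.cast_zero, zero_add, mul_one]
    exact ⟨hi3.trans hδr, hi3⟩

/-- For a sparse configuration, the up-crossings are the entrances into the discs of radius
`ρ` around the nodes without users. -/
theorem encard_upCrossingSet_inter_Iic (hM : M.Admissible) (hb : b 0 = M.dir)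
    (hx : IsLocallyFiniteConfig x) (hu : IsLocallyFiniteConfig u) {δ ℓ : ℝ} (hδ : 0 < δ)
    (hδr : M.rateRadius δ ≤ M.coverageRadius M.gam)
    (hs : IsSparse b x (M.rateRadius δ) (M.rateRadius (2 * δ)) ℓ) :
    (upCrossingSet (M.lowerSharedRate x u) δ ∩ Iic (ℓ / M.v)).encard =
      freeCount (M.coverageRadius M.gam) x u (pathTube b 0 ℓ (M.rateRadius δ)) := by
  have hρ := rateRadius_pos hM hδ
  have hv := hM.v_pos
  have hiff := fun t => le_lowerSharedRate_iff_exists hM hb hx hu hδ hδr hs (t := t)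
  set ρ := M.rateRadius δ with hρdef
  set r := M.coverageRadius M.gam
  set G : Set ℕ := {i | x i ∈ freeRegion r u ∩ pathTube b 0 ℓ ρ} with hG
  have hGfin : G.Finite := by
    refine (hx 0 (|ℓ| + ρ)).subset fun i hi => ?_
    obtain ⟨-, ⟨h1, h2⟩, h3⟩ := hi
    rw [mem_ofPred_eq, Metric.mem_closedBall]
    have h4 := dist_sq_eq_coord b (x i) 0
    simp only [map_zero, PiLp.zero_apply, sub_zero] at h4
    have h5 : b.repr (x i) 1 ^ 2 ≤ ρ ^ 2 := by
      rw [sq_le_sq, abs_of_pos hρ]; exact (abs_lt.2 h3).le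
    have h6 : b.repr (x i) 0 ^ 2 ≤ |ℓ| ^ 2 := by
      rw [sq_abs]; nlinarith
    refine abs_le_of_sq_le_sq ?_ (by positivity) |> (le_abs_self _).trans
    nlinarith [abs_nonneg ℓ]
  -- `h i` is half the chord that the path cuts from the disc of radius ρ around node `i`, and `α i`
  -- below is the time of entrance.
  set h : ℕ → ℝ := fun i => √(ρ ^ 2 - b.repr (x i) 1 ^ 2) with hh
  set α : ℕ → ℝ := fun i => (b.repr (x i) 0 - h i) / M.v with hα
  have hlt : ∀ i ∈ G, |b.repr (x i) 1| < ρ := fun i hi => abs_lt.2 hi.2.2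
  have hhpos : ∀ i ∈ G, 0 < h i := fun i hi => Real.sqrt_pos.2 (by
    have : b.repr (x i) 1 ^ 2 < ρ ^ 2 := by
      rw [sq_lt_sq, abs_of_pos hρ]; exact hlt i hi
    linarith)
  have hhle : ∀ i, h i ≤ ρ := fun i => Real.sqrt_le_iff.2 ⟨hρ.le, by nlinarith [sq_nonneg (b.repr (x i) 1)]⟩
  -- Since the two end boxes are empty, every chord lies strictly inside the observed stretch of the
  -- path.
  have hloc : ∀ i ∈ G, ρ < b.repr (x i) 0 ∧ b.repr (x i) 0 < ℓ - 2 * ρ := by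
    intro i hi
    obtain ⟨-, ⟨h1, h2⟩, h3⟩ := hi
    constructor
    · by_contra! hcon
      exact hs.notMem_start i ⟨⟨by linarith, hcon⟩, h3.1.le, h3.2.le⟩
    · by_contra! hcon
      exact hs.notMem_end i ⟨⟨hcon, by linarith⟩, h3.1.le, h3.2.le⟩
  have hchord : ∀ i ∈ G, ∀ t, dist (M.position t) (x i) ≤ ρ ↔
      α i ≤ t ∧ M.v * t ≤ b.repr (x i) 0 + h i := by
    intro i hi t
    rw [dist_position_le_iff hb hρ.le t (hlt i hi), abs_le, hα, div_le_iff₀ hv]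
    constructor <;> rintro ⟨h1, h2⟩ <;> constructor <;> linarith
  have hvα : ∀ i, M.v * α i = b.repr (x i) 0 - h i := fun i => by
    simp only [hα]; field_simp
  have hαmem : ∀ i ∈ G, dist (M.position (α i)) (x i) ≤ ρ := fun i hi =>
    (hchord i hi _).2 ⟨le_rfl, by rw [hvα]; linarith [hhpos i hi]⟩
  have hsep : ∀ i ∈ G, ∀ j, i ≠ j → ∀ t, dist (M.position t) (x i) ≤ ρ →
      ¬ dist (M.position t) (x j) ≤ ρ := by
    intro i hi j hij t h1 h2
    have h3 := hs.separated i j hij hi.2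
    have h4 := dist_triangle_left (x i) (x j) (M.position t)
    linarith
  have hclosed : ∀ i t, ¬ dist (M.position t) (x i) ≤ ρ →
      ∀ᶠ s in 𝓝 t, ¬ dist (M.position s) (x i) ≤ ρ := by
    intro i t ht
    have hc : Continuous fun s => dist (M.position s) (x i) :=
      M.continuous_position.dist continuous_const
    filter_upwards [hc.continuousAt.eventually_const_lt (not_le.1 ht)] with s hs using not_le.2 hs
  have hαpos : ∀ i ∈ G, 0 < α i := fun i hi =>
    div_pos (by linarith [hloc i hi, hhle i]) hv
  have himage : upCrossingSet (M.lowerSharedRate x u) δ ∩ Iic (ℓ / M.v) = α '' G := by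
    ext t
    rw [mem_inter_iff, mem_upCrossingSet_iff, mem_Iic, le_div_iff₀' hv]
    constructor
    · rintro ⟨⟨ht0, hleft, hright⟩, htℓ⟩
      have hnear : ∀ᶠ s in 𝓝 t, 0 < s ∧ M.v * s < ℓ + ρ := by
        refine (lt_mem_nhds ht0).and ?_
        exact (by fun_prop : Continuous fun s => M.v * s).continuousAt.eventually_lt_const
          (by linarith)
      -- The discs are closed and finitely many, so if t were outside all of them the path would
      -- still be low just after t.
      have hex : ∃ i ∈ G, dist (M.position t) (x i) ≤ ρ := by
        by_contra! hcon
        have h1 : ∀ᶠ s in 𝓝[>] t, ∀ i ∈ G, ¬ dist (M.position s) (x i) ≤ ρ :=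
          (eventually_all_finite hGfin).2 fun i hi =>
            (hclosed i t (not_le.2 (hcon i hi))).filter_mono nhdsWithin_le_nhds
        obtain ⟨s, h1, h2, h3⟩ := (h1.and (hright.and (hnear.filter_mono nhdsWithin_le_nhds))).exists
        obtain ⟨i, hi, hd⟩ := (hiff s (mul_pos hv h3.1).le h3.2.le).1 h2
        exact h1 i hi hd
      obtain ⟨i, hi, hd⟩ := hex
      refine ⟨i, hi, ?_⟩
      obtain ⟨h1, h2⟩ := (hchord i hi t).1 hd
      -- Had the disc been entered before t, the path would already be high just before t.
      by_contra hne
      have hlt' : α i < t := lt_of_le_of_ne h1 hne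
      have hIoo : ∀ᶠ s in 𝓝[<] t, s ∈ Ioo (α i) t := Ioo_mem_nhdsLT hlt'
      obtain ⟨s, h3, h4, h5⟩ :=
        (hleft.and (hIoo.and (hnear.filter_mono nhdsWithin_le_nhds))).exists
      refine absurd ((hiff s (mul_pos hv h5.1).le h5.2.le).2 ⟨i, hi, (hchord i hi s).2 ⟨h4.1.le, ?_⟩⟩)
        (not_le.2 h3)
      nlinarith [h4.2]
    · rintro ⟨i, hi, rfl⟩
      have hl := hloc i hi
      have hp := hhpos i hi
      refine ⟨⟨hαpos i hi, ?_, ?_⟩, by rw [hvα]; linarith⟩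
      -- At its entrance time the user is outside every other disc, and stays outside nearby; before
      -- the entrance it is outside disc `i` as well.
      · have h1 : ∀ᶠ s in 𝓝 (α i), ∀ j ∈ G \ {i}, ¬ dist (M.position s) (x j) ≤ ρ :=
          (eventually_all_finite hGfin.sdiff).2 fun j hj =>
            hclosed j _ (hsep i hi j (fun h => hj.2 h.symm) _ (hαmem i hi))
        filter_upwards [h1.filter_mono nhdsWithin_le_nhds, Ioo_mem_nhdsLT (hαpos i hi)] with s hs1 hs2
        by_contra! hcon
        have hvs : M.v * s < M.v * α i := mul_lt_mul_of_pos_left hs2.2 hv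
        rw [hvα] at hvs
        obtain ⟨j, hj, hd⟩ := (hiff s (mul_pos hv hs2.1).le (by linarith)).1 hcon
        by_cases hji : j = i
        · subst hji
          exact absurd ((hchord j hi s).1 hd).1 (not_le.2 hs2.2)
        · exact hs1 j ⟨hj, hji⟩ hd
      · have h1 : α i < (b.repr (x i) 0 + h i) / M.v := by
          rw [lt_div_iff₀' hv, hvα]; linarith
        filter_upwards [Ioo_mem_nhdsGT h1] with s hs
        have h2 : M.v * s < b.repr (x i) 0 + h i := (lt_div_iff₀' hv).1 hs.2
        exact (hiff s (mul_pos hv ((hαpos i hi).trans hs.1)).le (by linarith [hhle i])).2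
          ⟨i, hi, (hchord i hi s).2 ⟨hs.1.le, h2.le⟩⟩
  have hinj : InjOn α G := by
    intro i hi j hj hij
    by_contra hne
    refine hsep i hi j hne (α i) (hαmem i hi) ?_
    rw [hij]
    exact hαmem j hj
  rw [himage, hinj.encard_image]
  rfl

end NetworkParams

/-! ### Tubes around the path and almost sure crossings -/

namespace NetworkParams

theorem measurableSet_pathTube (b : OrthonormalBasis (Fin 2) ℝ Plane) (s ℓ ρ : ℝ) :
    MeasurableSet (pathTube b s ℓ ρ) := measurableSet_coordBox b measurableSet_Ioc measurableSet_Ioo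

theorem volume_pathTube_ne_top (b : OrthonormalBasis (Fin 2) ℝ Plane) (s ℓ ρ : ℝ) :
    volume (pathTube b s ℓ ρ) ≠ ⊤ := by
  rw [pathTube, volume_coordBox b measurableSet_Ioc measurableSet_Ioo]
  exact ENNReal.mul_ne_top (by simp) (by simp)

theorem volume_real_pathTube (b : OrthonormalBasis (Fin 2) ℝ Plane) {s ℓ ρ : ℝ} (h : s ≤ ℓ)
    (hρ : 0 ≤ ρ) : volume.real (pathTube b s ℓ ρ) = (ℓ - s) * (2 * ρ) := by
  rw [pathTube, volume_real_coordBox b measurableSet_Ioc measurableSet_Ioo, Real.volume_real_Ioc_of_le h,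
    Real.volume_real_Ioo_of_le (by linarith)]
  ring

theorem disjoint_pathTube (b : OrthonormalBasis (Fin 2) ℝ Plane) {s ℓ s' ℓ' : ℝ} (h : ℓ ≤ s')
    (ρ : ℝ) : Disjoint (pathTube b s ℓ ρ) (pathTube b s' ℓ' ρ) :=
  Set.disjoint_left.2 fun _ hy hy' => absurd (hy.1.2.trans h) (not_le.2 hy'.1.1)

theorem pathTube_union (b : OrthonormalBasis (Fin 2) ℝ Plane) {s t ℓ : ℝ} (h : s ≤ t) (h' : t ≤ ℓ)
    (ρ : ℝ) : pathTube b s t ρ ∪ pathTube b t ℓ ρ = pathTube b s ℓ ρ := by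
  ext y
  have : b.repr y 0 ∈ Ioc s ℓ ↔ b.repr y 0 ∈ Ioc s t ∨ b.repr y 0 ∈ Ioc t ℓ := by
    rw [← mem_union, Ioc_union_Ioc_eq_Ioc h h']
  simp only [pathTube, coordBox, mem_union, mem_ofPred_eq, this]
  tauto

end NetworkParams

namespace IsPoissonPointProcess

open NetworkParams

variable {Ω : Type*} [MeasurableSpace Ω] {P : Measure Ω} [IsProbabilityMeasure P]
  {X U : ℕ → Ω → Plane} {lam xi : ℝ}

/-- The free area of a thin tube concentrates around its mean. -/
theorem integral_abs_volume_freeRegion_pathTube_sub_le (hU : IsPoissonPointProcess P U xi)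
    (hxi : 0 < xi) {r : ℝ} (hr : 0 ≤ r) (hl : 0 < lam) (b : OrthonormalBasis (Fin 2) ℝ Plane)
    {s ℓ ρ : ℝ} (h : s ≤ ℓ) (hρ : 0 ≤ ρ) :
    ∫ ω, |lam * volume.real (freeRegion r (fun j => U j ω) ∩ pathTube b s ℓ ρ) -
        lam * Real.exp (-(xi * Real.pi * r ^ 2)) * ((ℓ - s) * (2 * ρ))| ∂P ≤
      lam * √(8 * r * ρ * ((ℓ - s) * (2 * ρ))) := by
  -- A disc of radius 2r meets the tube inside a box of length 4r and width 2ρ.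
  have hW : ∀ y, volume.real (pathTube b s ℓ ρ ∩ Metric.closedBall y (2 * r)) ≤ 8 * r * ρ := by
    intro y
    have hsub : pathTube b s ℓ ρ ∩ Metric.closedBall y (2 * r) ⊆
        coordBox b (Icc (b.repr y 0 - 2 * r) (b.repr y 0 + 2 * r)) (Ioo (-ρ) ρ) := by
      rintro z ⟨hz, hzy⟩
      have h1 := abs_le.1 ((abs_coord_sub_le_dist b z y 0).trans hzy)
      exact ⟨⟨by linarith, by linarith⟩, hz.2⟩
    refine (measureReal_mono hsub ?_).trans (le_of_eq ?_)
    · rw [volume_coordBox b measurableSet_Icc measurableSet_Ioo]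
      exact ENNReal.mul_ne_top (by simp) (by simp)
    · rw [volume_real_coordBox b measurableSet_Icc measurableSet_Ioo,
        Real.volume_real_Icc_of_le (by linarith), Real.volume_real_Ioo_of_le (by linarith)]
      ring
  have hmain := hU.integral_abs_volume_freeRegion_sub_le hxi hr
    (volume_pathTube_ne_top b s ℓ ρ) hW
  rw [volume_real_pathTube b h hρ] at hmain
  refine le_trans (le_of_eq ?_) (mul_le_mul_of_nonneg_left hmain hl.le)
  rw [← integral_const_mul]
  refine integral_congr_ae (Eventually.of_forall fun ω => ?_)
  simp only
  rw [mul_assoc, ← mul_sub, abs_mul, abs_of_pos hl]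

/-- Arbitrarily far along the path, there are nodes close to the path without users around. -/
theorem ae_exists_mem_freeRegion_pathTube (hX : IsPoissonPointProcess P X lam) (hl : 0 < lam)
    (hU : IsPoissonPointProcess P U xi) (hxi : 0 < xi)
    (hXU : IndepFun (fun ω i => X i ω) (fun ω j => U j ω) P) {r : ℝ} (hr : 0 ≤ r)
    (b : OrthonormalBasis (Fin 2) ℝ Plane) {ε : ℝ} (hε : 0 < ε) :
    ∀ᵐ ω ∂P, ∀ T : ℝ, ∃ i, X i ω ∈ freeRegion r (fun j => U j ω) ∧
      T < b.repr (X i ω) 0 ∧ |b.repr (X i ω) 1| < ε := by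
  suffices h : ∀ m : ℕ, ∀ᵐ ω ∂P, ∃ i, X i ω ∈ freeRegion r (fun j => U j ω) ∧
      (m : ℝ) < b.repr (X i ω) 0 ∧ |b.repr (X i ω) 1| < ε by
    filter_upwards [ae_all_iff.2 h] with ω hω T
    obtain ⟨m, hm⟩ := exists_nat_ge T
    obtain ⟨i, h1, h2, h3⟩ := hω m
    exact ⟨i, h1, hm.trans_lt h2, h3⟩
  intro m
  set κ := Real.exp (-(xi * Real.pi * r ^ 2)) with hκ
  have hκ0 : 0 < κ := Real.exp_pos _
  set A : Set Ω := {ω | ¬ ∃ i, X i ω ∈ freeRegion r (fun j => U j ω) ∧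
      (m : ℝ) < b.repr (X i ω) 0 ∧ |b.repr (X i ω) 1| < ε}
  -- A tube of fixed area τ is made ever thinner and longer: ρ → 0 removes the fluctuations of the
  -- free area, and then τ → ∞ removes the probability of finding no free node.
  have hA : ∀ τ > 0, ∀ ρ > 0, ρ < ε → P.real A ≤
      2 * (Real.exp (-(lam * κ * τ / 2)) + lam * √(8 * r * ρ * τ)) := by
    intro τ hτ ρ hρ hρε
    have hle : (m : ℝ) ≤ m + τ / (2 * ρ) := by have : 0 < τ / (2 * ρ) := by positivity
                                               linarith
    have hvol : ((m + τ / (2 * ρ) : ℝ) - m) * (2 * ρ) = τ := by field_simp; ring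
    have h1 := hU.integral_abs_volume_freeRegion_pathTube_sub_le hxi hr hl b hle hρ.le
    rw [hvol] at h1
    have h2 := real_freeCount_lt_le hX hl hU.measurable_point hXU r
      (measurableSet_pathTube b m (m + τ / (2 * ρ)) ρ)
      (volume_pathTube_ne_top b m (m + τ / (2 * ρ)) ρ) 1 (μ := lam * κ * τ) (by positivity)
    have h3 : P.real A ≤ P.real {ω | freeCount r (fun i => X i ω) (fun j => U j ω)
        (pathTube b m (m + τ / (2 * ρ)) ρ) < (1 : ℕ)} := by
      refine measureReal_mono fun ω hω => ?_
      have : freeCount r (fun i => X i ω) (fun j => U j ω)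
          (pathTube b m (m + τ / (2 * ρ)) ρ) = 0 := by
        refine (pointCount_eq_zero_iff _ _).2 fun i hi => hω ⟨i, hi.1, hi.2.1.1, ?_⟩
        exact (abs_lt.2 hi.2.2).trans hρε
      rw [mem_ofPred_eq, this]
      norm_num
    refine (h3.trans h2).trans ?_
    rw [pow_one]
    gcongr
  have hlim1 : ∀ τ > 0, P.real A ≤ 2 * (Real.exp (-(lam * κ * τ / 2)) + lam * 0) := by
    intro τ hτ
    have hc : Tendsto (fun ρ : ℝ => 2 * (Real.exp (-(lam * κ * τ / 2)) + lam * √(8 * r * ρ * τ)))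
        (𝓝[>] 0) (𝓝 (2 * (Real.exp (-(lam * κ * τ / 2)) + lam * 0))) := by
      refine Tendsto.mono_left ?_ nhdsWithin_le_nhds
      have : Continuous fun ρ : ℝ => 2 * (Real.exp (-(lam * κ * τ / 2)) + lam * √(8 * r * ρ * τ)) := by
        fun_prop
      simpa using this.tendsto 0
    refine ge_of_tendsto hc ?_
    filter_upwards [Ioo_mem_nhdsGT hε] with ρ hρ using hA τ hτ ρ hρ.1 hρ.2
  have hlim2 : Tendsto (fun τ : ℝ => 2 * (Real.exp (-(lam * κ * τ / 2)) + lam * 0)) atTop (𝓝 0) := by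
    have h1 : Tendsto (fun τ : ℝ => lam * κ / 2 * τ) atTop atTop :=
      tendsto_id.const_mul_atTop (by positivity)
    have h2 := (Real.tendsto_exp_neg_atTop_nhds_zero.comp h1).const_mul 2
    simp only [mul_zero, add_zero]
    rw [mul_zero] at h2
    refine h2.congr fun τ => ?_
    simp only [Function.comp]; ring_nf
  have h0 : P.real A ≤ 0 := ge_of_tendsto hlim2 (by
    filter_upwards [eventually_gt_atTop 0] with τ hτ using hlim1 τ hτ)
  exact (measureReal_eq_zero_iff (measure_ne_top _ _)).1 (le_antisymm h0 measureReal_nonneg)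

theorem ae_coord_ne_zero (hX : IsPoissonPointProcess P X lam) (hl : 0 < lam)
    (b : OrthonormalBasis (Fin 2) ℝ Plane) (d : ℝ) : ∀ᵐ ω ∂P, ∀ i, b.repr (X i ω) 1 ≠ d := by
  have h := hX.ae_forall_notMem hl (measurableSet_coordBox b MeasurableSet.univ
    (measurableSet_singleton d)) (by
      rw [volume_coordBox b MeasurableSet.univ (measurableSet_singleton d)]; simp)
  filter_upwards [h] with ω hω i hi using hω i ⟨mem_univ _, hi⟩

/-- Low times come from node-free discs centred on the path, high times from nodes near the path
whose enlarged disc has no users; both occur arbitrarily far out. -/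
theorem ae_upCrossingSet {M : NetworkParams} (hM : M.Admissible)
    (hX : IsPoissonPointProcess P X M.lam) (hU : IsPoissonPointProcess P U M.xi)
    (hXU : IndepFun (fun ω i => X i ω) (fun ω j => U j ω) P) {δ : ℝ} (hδ : 0 < δ) :
    ∀ᵐ ω ∂P,
      (upCrossingSet (M.lowerSharedRate (fun i => X i ω) (fun j => U j ω)) δ).Infinite ∧
      ∀ t : ℝ,
        (upCrossingSet (M.lowerSharedRate (fun i => X i ω) (fun j => U j ω)) δ ∩ Iic t).Finite := by
  obtain ⟨b, hb⟩ := exists_orthonormalBasis_zero_eq hM.norm_dir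
  have hv := hM.v_pos
  have hr := coverageRadius_pos hM
  have hρ := rateRadius_pos hM hδ
  set r := M.coverageRadius M.gam
  set R := r + 1 with hR
  set ε := min r (M.rateRadius δ) / 2 with hε
  have hε0 : 0 < ε := half_pos (lt_min hr hρ)
  have hε1 : 2 * ε ≤ r := by rw [hε]; linarith [min_le_left r (M.rateRadius δ)]
  have hε2 : 2 * ε ≤ M.rateRadius δ := by rw [hε]; linarith [min_le_right r (M.rateRadius δ)]
  -- Centres 2R + 1 apart make the discs disjoint, and R > r makes the path vanish in a
  -- neighbourhood of the time at which the centre is reached.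
  have hempty := hX.ae_frequently_count_eq_zero hM.lam_pos
    (B := fun k => Metric.closedBall (M.position (k * ((2 * R + 1) / M.v))) R)
    (fun k => Metric.isClosed_closedBall.measurableSet)
    (V := ENNReal.ofReal R ^ 2 * ENNReal.ofReal Real.pi)
    (ENNReal.mul_ne_top (by simp) (by simp))
    (fun k => EuclideanSpace.volume_closedBall_fin_two _ _)
    (fun k l hkl => by
      refine Metric.closedBall_disjoint_closedBall ?_
      rw [dist_position_position hM, ← sub_mul, abs_mul,
        abs_of_pos (show 0 < (2 * R + 1) / M.v by positivity)]
      have h1 : (1 : ℝ) ≤ |(k : ℝ) - l| := by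
        have : (1 : ℤ) ≤ |(k : ℤ) - l| := Int.one_le_abs (by omega)
        exact_mod_cast this
      have h2 : M.v * (|(k : ℝ) - l| * ((2 * R + 1) / M.v)) = |(k : ℝ) - l| * (2 * R + 1) := by
        field_simp
      rw [h2]
      nlinarith)
  filter_upwards [hX.ae_finite_closedBall hM.lam_pos, hU.ae_finite_closedBall hM.xi_pos,
    hX.ae_coord_ne_zero hM.lam_pos b 0, hempty,
    hX.ae_exists_mem_freeRegion_pathTube hM.lam_pos hU hM.xi_pos hXU
      (r := r + 4 * ε) (by positivity) b hε0] with ω hx hu hline hlow hhigh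
  have hJ := hasLocallyFiniteLevelSet_lowerSharedRate (u := fun j => U j ω) hM hb hx hline hδ
  refine ⟨hJ.infinite_upCrossingSet (fun T => ?_) fun T => ?_, hJ.finite_upCrossingSet_inter_Iic⟩
  · have hstep : 0 < (2 * R + 1) / M.v := by positivity
    obtain ⟨m, hm⟩ := exists_nat_gt (T / ((2 * R + 1) / M.v))
    obtain ⟨k, hk, hempty⟩ := hlow m
    refine ⟨k * ((2 * R + 1) / M.v), ?_, eventually_lowerSharedRate_lt hδ (by linarith) hempty⟩
    rw [div_lt_iff₀ hstep] at hm
    have : (m : ℝ) ≤ k := by exact_mod_cast hk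
    exact hm.trans_le (by gcongr)
  · obtain ⟨i, h1, h2, h3⟩ := hhigh (M.v * T)
    refine ⟨b.repr (X i ω) 0 / M.v, (lt_div_iff₀' hv).2 h2,
      eventually_le_lowerSharedRate hM hb hx hu hline hδ hε1 hε2 h1 ?_⟩
    refine lt_of_le_of_lt ?_ (show ε < 2 * ε by linarith)
    rw [← abs_of_pos hε0, ← abs_of_nonneg (dist_nonneg (x := M.position _) (y := X i ω)),
      ← sq_le_sq, M.dist_position_sq hb, mul_div_cancel₀ _ hv.ne', sub_self, zero_pow two_ne_zero,
      zero_add, sq_le_sq, abs_of_pos hε0]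
    exact h3.le

/-- A union bound: first moments for the three forbidden boxes, quadratic bounds for close pairs,
and null sets for the coordinate conditions. -/
theorem real_not_isSparse_le (hX : IsPoissonPointProcess P X lam) (hl : 0 < lam)
    (b : OrthonormalBasis (Fin 2) ℝ Plane) {ρ ρ₂ ℓ : ℝ} (hρ : 0 < ρ) (hρ₂ : 0 ≤ ρ₂) (hℓ : 0 ≤ ℓ) :
    P.real {ω | ¬ IsSparse b (fun i => X i ω) ρ ρ₂ ℓ} ≤
      lam * ((ℓ + 3 * ρ) * (2 * ρ₂)) + lam * (2 * ρ * (2 * ρ)) + lam * (4 * ρ * (2 * ρ)) +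
        (ℓ / ρ + 1) * (lam * (5 * ρ * (6 * ρ))) ^ 2 := by
  have hbox : ∀ c d e : ℝ, c ≤ d → 0 ≤ e →
      MeasurableSet (coordBox b (Icc c d) (Icc (-e) e)) ∧
      volume (coordBox b (Icc c d) (Icc (-e) e)) ≠ ⊤ ∧
      volume.real (coordBox b (Icc c d) (Icc (-e) e)) = (d - c) * (2 * e) := by
    intro c d e hcd he
    refine ⟨measurableSet_coordBox b measurableSet_Icc measurableSet_Icc, ?_, ?_⟩
    · rw [volume_coordBox b measurableSet_Icc measurableSet_Icc]
      exact ENNReal.mul_ne_top (by simp) (by simp)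
    · rw [volume_real_coordBox b measurableSet_Icc measurableSet_Icc,
        Real.volume_real_Icc_of_le hcd, Real.volume_real_Icc_of_le (by linarith)]
      ring
  have hone : ∀ c d e : ℝ, c ≤ d → 0 ≤ e →
      P.real {ω | 1 ≤ pointCount (fun i => X i ω) (coordBox b (Icc c d) (Icc (-e) e))} ≤
        lam * ((d - c) * (2 * e)) := by
    intro c d e hcd he
    obtain ⟨h1, h2, h3⟩ := hbox c d e hcd he
    rw [← h3]
    exact hX.real_one_le_count_le hl h1 h2
  set E₁ := {ω | 1 ≤ pointCount (fun i => X i ω) (coordBox b (Icc (-ρ) (ℓ + 2 * ρ)) (Icc (-ρ₂) ρ₂))}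
  set E₂ := {ω | 1 ≤ pointCount (fun i => X i ω) (coordBox b (Icc (-ρ) ρ) (Icc (-ρ) ρ))}
  set E₃ := {ω | 1 ≤ pointCount (fun i => X i ω)
    (coordBox b (Icc (ℓ - 2 * ρ) (ℓ + 2 * ρ)) (Icc (-ρ) ρ))}
  -- If the first coordinate of the tube point lies in [kρ, (k+1)ρ), then a second point within 2ρ
  -- puts both in this 5ρ by 6ρ box.
  set E₄ := ⋃ k ∈ Finset.range (⌊ℓ / ρ⌋₊ + 1), {ω | 2 ≤ pointCount (fun i => X i ω)
    (coordBox b (Icc ((k - 2 : ℝ) * ρ) ((k + 3 : ℝ) * ρ)) (Icc (-(3 * ρ)) (3 * ρ)))}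
  set E₅ := {ω | ¬ ((∀ i, b.repr (X i ω) 1 ≠ 0) ∧ (∀ i, b.repr (X i ω) 1 ≠ ρ) ∧
    ∀ i, b.repr (X i ω) 1 ≠ -ρ)}
  have h5 : P.real E₅ = 0 := by
    refine (measureReal_eq_zero_iff (measure_ne_top _ _)).2 ?_
    exact (hX.ae_coord_ne_zero hl b 0).and ((hX.ae_coord_ne_zero hl b ρ).and
      (hX.ae_coord_ne_zero hl b (-ρ)))
  have hsub : {ω | ¬ IsSparse b (fun i => X i ω) ρ ρ₂ ℓ} ⊆ E₁ ∪ E₂ ∪ E₃ ∪ E₄ ∪ E₅ := by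
    intro ω hω
    by_contra hcon
    simp only [mem_union, not_or] at hcon
    obtain ⟨⟨⟨⟨c1, c2⟩, c3⟩, c4⟩, c5⟩ := hcon
    have c5' := not_not.1 c5
    refine hω ⟨fun i hi => c1 ((one_le_pointCount_iff _ _).2 ⟨i, hi⟩),
      fun i hi => c2 ((one_le_pointCount_iff _ _).2 ⟨i, hi⟩),
      fun i hi => c3 ((one_le_pointCount_iff _ _).2 ⟨i, hi⟩), fun i j hij hi => ?_, c5'.1,
      fun i hi => ?_⟩
    · by_contra! hd
      refine c4 (mem_biUnion (x := ⌊b.repr (X i ω) 0 / ρ⌋₊) ?_ ?_)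
      · simp only [Finset.coe_range, mem_Iio]
        have : b.repr (X i ω) 0 / ρ ≤ ℓ / ρ := by gcongr; exact hi.1.2
        exact Nat.lt_succ_of_le (Nat.floor_mono this)
      · have hf1 := Nat.floor_le (div_nonneg hi.1.1.le hρ.le)
        have hf2 := Nat.lt_floor_add_one (b.repr (X i ω) 0 / ρ)
        rw [le_div_iff₀ hρ] at hf1
        rw [div_lt_iff₀ hρ] at hf2
        have d0 := abs_le.1 ((abs_coord_sub_le_dist b (X i ω) (X j ω) 0).trans hd)
        have d1 := abs_le.1 ((abs_coord_sub_le_dist b (X i ω) (X j ω) 1).trans hd)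
        have t1 := hi.2.1
        have t2 := hi.2.2
        exact two_le_pointCount hij
          ⟨⟨by nlinarith, by nlinarith⟩, by linarith, by linarith⟩
          ⟨⟨by nlinarith, by nlinarith⟩, by linarith, by linarith⟩
    · rcases (abs_eq hρ.le).1 hi with h | h
      · exact c5'.2.1 i h
      · exact c5'.2.2 i h
  have h1 : P.real E₁ ≤ lam * ((ℓ + 3 * ρ) * (2 * ρ₂)) :=
    (hone _ _ _ (by linarith) hρ₂).trans (le_of_eq (by ring))
  have h2 : P.real E₂ ≤ lam * (2 * ρ * (2 * ρ)) :=
    (hone _ _ _ (by linarith) hρ.le).trans (le_of_eq (by ring))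
  have h3 : P.real E₃ ≤ lam * (4 * ρ * (2 * ρ)) :=
    (hone _ _ _ (by linarith) hρ.le).trans (le_of_eq (by ring))
  have h4 : P.real E₄ ≤ (ℓ / ρ + 1) * (lam * (5 * ρ * (6 * ρ))) ^ 2 := by
    refine (measureReal_biUnion_finset_le _ _).trans ?_
    have : ∀ k ∈ Finset.range (⌊ℓ / ρ⌋₊ + 1), P.real {ω | 2 ≤ pointCount (fun i => X i ω)
        (coordBox b (Icc ((k - 2 : ℝ) * ρ) ((k + 3 : ℝ) * ρ)) (Icc (-(3 * ρ)) (3 * ρ)))} ≤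
        (lam * (5 * ρ * (6 * ρ))) ^ 2 := by
      intro k _
      obtain ⟨m1, m2, m3⟩ := hbox ((k - 2 : ℝ) * ρ) ((k + 3 : ℝ) * ρ) (3 * ρ) (by nlinarith)
        (by positivity)
      refine (hX.real_two_le_count_le hl m1 m2).trans (le_of_eq ?_)
      rw [m3]; ring
    refine (Finset.sum_le_sum this).trans ?_
    rw [Finset.sum_const, Finset.card_range, nsmul_eq_mul]
    push_cast
    gcongr
    exact Nat.floor_le (by positivity)
  refine (measureReal_mono hsub).trans ?_
  have u1 := measureReal_union_le (μ := P) (E₁ ∪ E₂ ∪ E₃ ∪ E₄) E₅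
  have u2 := measureReal_union_le (μ := P) (E₁ ∪ E₂ ∪ E₃) E₄
  have u3 := measureReal_union_le (μ := P) (E₁ ∪ E₂) E₃
  have u4 := measureReal_union_le (μ := P) E₁ E₂
  linarith

end IsPoissonPointProcess

/-! ### Exponential gaps from asymptotic void probabilities -/

/-- The counting processes `C d` of the times `T d 1 ≤ T d 2 ≤ …` are, asymptotically along `l`,
close to the counts `H d` of a point process that is asymptotically Poisson with rate one. -/
structure IsAsymptoticallyPoisson {Ω ι : Type*} [MeasurableSpace Ω] (P : Measure Ω) (l : Filter ι)
    (T : ι → ℕ → Ω → ℝ) (C : ι → ℝ → Ω → ℕ∞) (H : ι → ℝ → ℝ → Ω → ℕ∞) : Prop where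
  measurable : ∀ d s t, Measurable (H d s t)
  self : ∀ d s ω, H d s s ω = 0
  add : ∀ᶠ d in l, ∀ s t u ω, s ≤ t → t ≤ u → H d s t ω + H d t u ω = H d s u ω
  count_eq : ∀ t ≥ 0, Tendsto (fun d => P.real {ω | C d t ω ≠ H d 0 t ω}) l (𝓝 0)
  time_le_iff : ∀ᶠ d in l, ∀ᵐ ω ∂P, ∀ n t, 0 ≤ t → (T d n ω ≤ t ↔ (n : ℕ∞) ≤ C d t ω)
  time_nonneg : ∀ᶠ d in l, ∀ n ω, 0 ≤ T d n ω
  void : ∀ (n : ℕ) (s t u : ℝ), 0 ≤ s → s ≤ t → t ≤ u →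
    Tendsto (fun d => P.real {ω | H d 0 s ω < n ∧ H d t u ω = 0} -
      Real.exp (-(u - t)) * P.real {ω | H d 0 s ω < n}) l (𝓝 0)
  lt_le : ∀ (n : ℕ), ∀ t ≥ 0, ∀ ε > 0, ∀ᶠ d in l,
    P.real {ω | H d 0 t ω < n} ≤ 2 ^ n * Real.exp (-(t / 2)) + ε
  two_le : ∃ D : ℝ, 0 ≤ D ∧ ∀ᶠ d in l, ∀ s t, 0 ≤ s → s ≤ t →
    P.real {ω | 2 ≤ H d s t ω} ≤ D * (t - s) ^ 2

namespace IsAsymptoticallyPoisson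

section

variable {Ω ι : Type*} {C : ι → ℝ → Ω → ℕ∞} {H : ι → ℝ → ℝ → Ω → ℕ∞}

/-- The `n`-th point lies in the cell `(kη, (k+1)η]` and there is no point during the time `y` after
this cell. -/
def gapEvent (H : ι → ℝ → ℝ → Ω → ℕ∞) (d : ι) (n : ℕ) (η y : ℝ) (k : ℕ) : Set Ω :=
  {ω | H d 0 (k * η) ω < n ∧ ¬ H d 0 ((k + 1 : ℕ) * η) ω < n ∧
    H d ((k + 1 : ℕ) * η) ((k + 1 : ℕ) * η + y) ω = 0}

theorem count_mono {d : ι}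
    (hadd : ∀ s t u ω, s ≤ t → t ≤ u → H d s t ω + H d t u ω = H d s u ω) {s t : ℝ}
    (hs : 0 ≤ s) (hst : s ≤ t) (ω : Ω) : H d 0 s ω ≤ H d 0 t ω := by
  rw [← hadd 0 s t ω hs hst]; exact le_self_add

theorem cell_le {η : ℝ} (hη : 0 < η) {k m : ℕ} (h : k ≤ m) : (k : ℝ) * η ≤ m * η := by
  have : (k : ℝ) ≤ m := by exact_mod_cast h
  gcongr

theorem cell_nonneg {η : ℝ} (hη : 0 < η) (k : ℕ) : 0 ≤ (k : ℝ) * η := by positivity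

/-- The event that `C` and `H` differ at one of the times used for the cells of size `η`. -/
def gridMismatch (C : ι → ℝ → Ω → ℕ∞) (H : ι → ℝ → ℝ → Ω → ℕ∞) (d : ι) (η y : ℝ) (K : ℕ) : Set Ω :=
  ⋃ k ∈ Finset.range (K + 1), ({ω | C d (k * η) ω ≠ H d 0 (k * η) ω} ∪
    {ω | C d (k * η + y) ω ≠ H d 0 (k * η + y) ω})

theorem eq_of_notMem_gridMismatch {d : ι} {η y : ℝ} {K k : ℕ} {ω : Ω}
    (hω : ω ∉ gridMismatch C H d η y K) (hk : k ≤ K) :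
    C d (k * η) ω = H d 0 (k * η) ω ∧ C d (k * η + y) ω = H d 0 (k * η + y) ω := by
  simp only [gridMismatch, mem_iUnion, Finset.mem_range, not_exists, mem_union, not_or,
    mem_ofPred_eq, not_not] at hω
  exact hω k (by omega)

end

variable {Ω ι : Type*} [MeasurableSpace Ω] {P : Measure Ω} {l : Filter ι}
  {T : ι → ℕ → Ω → ℝ} {C : ι → ℝ → Ω → ℕ∞} {H : ι → ℝ → ℝ → Ω → ℕ∞}

theorem measurableSet_gapEvent (h : IsAsymptoticallyPoisson P l T C H) (d : ι) (n : ℕ) (η y : ℝ)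
    (k : ℕ) : MeasurableSet (gapEvent H d n η y k) := by
  have h1 : ∀ t, MeasurableSet {ω | H d 0 t ω < n} := fun t =>
    h.measurable d 0 t (MeasurableSet.of_discrete (s := Iio (n : ℕ∞)))
  exact (h1 _).inter ((h1 _).compl.inter (h.measurable d _ _ (measurableSet_singleton 0)))

theorem tendsto_real_gridMismatch (h : IsAsymptoticallyPoisson P l T C H) {η y : ℝ} (hη : 0 < η)
    (hy : 0 ≤ y) (K : ℕ) : Tendsto (fun d => P.real (gridMismatch C H d η y K)) l (𝓝 0) := by
  have hlim : Tendsto (fun d => ∑ k ∈ Finset.range (K + 1),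
      (P.real {ω | C d (k * η) ω ≠ H d 0 (k * η) ω} +
        P.real {ω | C d (k * η + y) ω ≠ H d 0 (k * η + y) ω})) l
      (𝓝 (∑ k ∈ Finset.range (K + 1), ((0 : ℝ) + 0))) :=
    tendsto_finsetSum _ fun k _ => (h.count_eq _ (cell_nonneg hη k)).add
      (h.count_eq _ (by have := cell_nonneg hη k; linarith))
  simp only [add_zero, Finset.sum_const_zero] at hlim
  refine squeeze_zero (fun _ => measureReal_nonneg) (fun d => ?_) hlim
  exact (measureReal_biUnion_finset_le _ _).trans
    (Finset.sum_le_sum fun k _ => measureReal_union_le _ _)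

variable [IsProbabilityMeasure P]

/-- Counts are monotone, so the n-th point lies in at most one cell and the events are disjoint. -/
theorem real_iUnion_gapEvent (h : IsAsymptoticallyPoisson P l T C H) {d : ι}
    (hadd : ∀ s t u ω, s ≤ t → t ≤ u → H d s t ω + H d t u ω = H d s u ω) (n : ℕ) {η : ℝ}
    (hη : 0 < η) (y : ℝ) (K : ℕ) :
    P.real (⋃ k ∈ Finset.range K, gapEvent H d n η y k) =
      ∑ k ∈ Finset.range K, P.real (gapEvent H d n η y k) := by
  refine measureReal_biUnion_finset ?_ fun k _ => h.measurableSet_gapEvent d n η y k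
  have key : ∀ k m : ℕ, k < m → Disjoint (gapEvent H d n η y k) (gapEvent H d n η y m) := by
    refine fun k m hkm => Set.disjoint_left.2 fun ω h1 h2 => h1.2.1 (lt_of_le_of_lt ?_ h2.1)
    exact count_mono hadd (cell_nonneg hη _) (cell_le hη hkm) ω
  intro k _ m _ hkm
  rcases lt_or_gt_of_ne hkm with h1 | h1
  · exact key k m h1
  · exact (key m k h1).symm

/-- Each gap event is a difference of two nested events "fewer than n points so far, then none",
with the first count stopped at the left or the right end of the cell. The void asymptotics apply to
both, and the sum over cells telescopes. -/
theorem tendsto_sum_real_gapEvent (h : IsAsymptoticallyPoisson P l T C H) {n : ℕ} (hn : 1 ≤ n)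
    {η y : ℝ} (hη : 0 < η) (hy : 0 ≤ y) (K : ℕ) :
    Tendsto (fun d => ∑ k ∈ Finset.range K, P.real (gapEvent H d n η y k) -
      Real.exp (-y) * (1 - P.real {ω | H d 0 (K * η) ω < n})) l (𝓝 0) := by
  have hterm : ∀ k : ℕ, Tendsto (fun d => P.real (gapEvent H d n η y k) -
      Real.exp (-y) * (P.real {ω | H d 0 (k * η) ω < n} -
        P.real {ω | H d 0 ((k + 1 : ℕ) * η) ω < n})) l (𝓝 0) := by
    intro k
    have e1 := h.void n (k * η) ((k + 1 : ℕ) * η) ((k + 1 : ℕ) * η + y) (cell_nonneg hη k)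
      (cell_le hη k.le_succ) (by linarith)
    have e2 := h.void n ((k + 1 : ℕ) * η) ((k + 1 : ℕ) * η) ((k + 1 : ℕ) * η + y)
      (cell_nonneg hη _) le_rfl (by linarith)
    have e3 := e1.sub e2
    rw [sub_zero] at e3
    refine e3.congr' ?_
    filter_upwards [h.add] with d hadd
    have hW : gapEvent H d n η y k =
        {ω | H d 0 (k * η) ω < n ∧ H d ((k + 1 : ℕ) * η) ((k + 1 : ℕ) * η + y) ω = 0} \
          {ω | H d 0 ((k + 1 : ℕ) * η) ω < n ∧
            H d ((k + 1 : ℕ) * η) ((k + 1 : ℕ) * η + y) ω = 0} := by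
      ext ω
      simp only [gapEvent, mem_ofPred_eq, Set.mem_sdiff]
      tauto
    have hms : MeasurableSet {ω | H d 0 ((k + 1 : ℕ) * η) ω < n ∧
        H d ((k + 1 : ℕ) * η) ((k + 1 : ℕ) * η + y) ω = 0} :=
      (h.measurable d 0 _ (MeasurableSet.of_discrete (s := Iio (n : ℕ∞)))).inter
        (h.measurable d _ _ (measurableSet_singleton 0))
    rw [hW, measureReal_sdiff ?_ hms]
    · rw [add_sub_cancel_left]; ring
    · exact fun ω hω => ⟨(count_mono hadd (cell_nonneg hη _) (cell_le hη k.le_succ) ω).trans_lt hω.1,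
        hω.2⟩
  have hsum := tendsto_finsetSum (Finset.range K) fun k _ => hterm k
  rw [Finset.sum_const_zero] at hsum
  refine hsum.congr fun d => ?_
  -- The telescoping sum starts at 1 because n ≥ 1 and there is no point at time 0.
  have h0 : P.real {ω | H d 0 ((0 : ℕ) * η) ω < n} = 1 := by
    have : {ω | H d 0 ((0 : ℕ) * η) ω < n} = univ := by
      refine eq_univ_of_forall fun ω => ?_
      simp only [Nat.cast_zero, zero_mul, h.self, mem_ofPred_eq]
      exact_mod_cast hn
    rw [this, probReal_univ]
  rw [Finset.sum_sub_distrib, ← Finset.mul_sum,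
    Finset.sum_range_sub' (fun k : ℕ => P.real {ω | H d 0 (k * η) ω < n}), h0]

/-- Upper bound of the distribution function of a gap. -/
theorem eventually_real_gap_le (h : IsAsymptoticallyPoisson P l T C H) {n : ℕ} (hn : 1 ≤ n)
    {D : ℝ} (hD : ∀ᶠ d in l, ∀ s t, 0 ≤ s → s ≤ t → P.real {ω | 2 ≤ H d s t ω} ≤ D * (t - s) ^ 2)
    {η x : ℝ} (hη : 0 < η) (hx : 0 ≤ x) (K : ℕ) {ε : ℝ} (hε : 0 < ε) :
    ∀ᶠ d in l, P.real {ω | T d (n + 1) ω - T d n ω ≤ x} ≤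
      1 - Real.exp (-x) + 2 ^ n * Real.exp (-(K * η / 2)) + K * (D * η ^ 2) + ε := by
  have ε3 : 0 < ε / 3 := by positivity
  filter_upwards [h.add, h.time_le_iff, hD, h.lt_le n (K * η) (cell_nonneg hη K) (ε / 3) ε3,
    (h.tendsto_sum_real_gapEvent hn hη hx K).eventually_const_lt (show -(ε / 3) < 0 by linarith),
    (h.tendsto_real_gridMismatch hη hx K).eventually_lt_const ε3]
    with d hadd htime hD hlt hsum hmis
  set W := ⋃ k ∈ Finset.range K, gapEvent H d n η x k
  set B := gridMismatch C H d η x K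
  set D₂ := ⋃ k ∈ Finset.range K, {ω | 2 ≤ H d (k * η) ((k + 1 : ℕ) * η) ω}
  set N := {ω | ¬ ∀ n t, 0 ≤ t → (T d n ω ≤ t ↔ (n : ℕ∞) ≤ C d t ω)}
  have hN : P.real N = 0 := (measureReal_eq_zero_iff (measure_ne_top _ _)).2 htime
  have hWm : MeasurableSet W :=
    Finset.measurableSet_biUnion _ fun k _ => h.measurableSet_gapEvent d n η x k
  -- If the n-th point lies in cell k, alone beyond the earlier ones, and the following time x is
  -- empty, then the (n+1)-st time exceeds (k+1)η + x while the n-th is at most (k+1)η: the gap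
  -- exceeds x.
  have hsub : {ω | T d (n + 1) ω - T d n ω ≤ x} ⊆ Wᶜ ∪ B ∪ D₂ ∪ N := by
    intro ω hω
    by_contra hcon
    simp only [mem_union, not_or, mem_compl_iff, not_not] at hcon
    obtain ⟨⟨⟨hW, hB⟩, hD₂⟩, hNω⟩ := hcon
    have htime := not_not.1 hNω
    obtain ⟨k, hk, hWk⟩ := mem_iUnion₂.1 hW
    have hkK := Finset.mem_range.1 hk
    obtain ⟨w1, w2, w3⟩ := hWk
    have e1 := eq_of_notMem_gridMismatch hB (k := k + 1) hkK
    have hc0 := cell_nonneg hη (k + 1)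
    have hcell : H d (k * η) ((k + 1 : ℕ) * η) ω ≤ 1 := by
      by_contra! hcon
      exact hD₂ (mem_biUnion hk (Order.add_one_le_of_lt hcon |>.trans' (by norm_num)))
    have hle : H d 0 ((k + 1 : ℕ) * η) ω < (n + 1 : ℕ) := by
      rw [← hadd 0 (k * η) _ ω (cell_nonneg hη k) (cell_le hη k.le_succ)]
      exact (ENat.add_lt_add_of_lt_of_le (hcell.trans_lt (by simp)).ne w1 hcell).trans_eq
        (Nat.cast_succ n).symm
    have hgap : H d 0 ((k + 1 : ℕ) * η + x) ω < (n + 1 : ℕ) := by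
      rw [← hadd 0 ((k + 1 : ℕ) * η) _ ω hc0 (by linarith), w3, add_zero]; exact hle
    have t1 : T d n ω ≤ (k + 1 : ℕ) * η := (htime n _ hc0).2 (by rw [e1.1]; exact not_lt.1 w2)
    have t2 : ¬ T d (n + 1) ω ≤ (k + 1 : ℕ) * η + x := fun hcon => by
      have := (htime (n + 1) _ (by linarith)).1 hcon
      rw [e1.2] at this
      exact absurd this (not_le.2 hgap)
    have hω' : T d (n + 1) ω - T d n ω ≤ x := hω
    linarith
  have hD₂le : P.real D₂ ≤ K * (D * η ^ 2) := by
    refine (measureReal_biUnion_finset_le _ _).trans ?_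
    refine (Finset.sum_le_sum fun (k : ℕ) _ => hD (k * η) ((k + 1 : ℕ) * η) (cell_nonneg hη k)
      (cell_le hη k.le_succ)).trans (le_of_eq ?_)
    have : ∀ k : ℕ, ((k + 1 : ℕ) * η - k * η) = η := fun k => by push_cast; ring
    simp only [this, Finset.sum_const, Finset.card_range, nsmul_eq_mul]
  have hW : P.real Wᶜ = 1 - ∑ k ∈ Finset.range K, P.real (gapEvent H d n η x k) := by
    rw [measureReal_compl hWm, probReal_univ, h.real_iUnion_gapEvent hadd n hη x K]
  have u0 := measureReal_mono (μ := P) hsub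
  have u1 := measureReal_union_le (μ := P) (Wᶜ ∪ B ∪ D₂) N
  have u2 := measureReal_union_le (μ := P) (Wᶜ ∪ B) D₂
  have u3 := measureReal_union_le (μ := P) Wᶜ B
  set q := P.real {ω | H d 0 (K * η) ω < n}
  have hq : 0 ≤ q := measureReal_nonneg
  have hex : Real.exp (-x) ≤ 1 := Real.exp_le_one_iff.2 (by linarith)
  have : Real.exp (-x) * q ≤ q := mul_le_of_le_one_left hq hex
  nlinarith

/-- Lower bound of the distribution function of a gap. -/
theorem eventually_le_real_gap (h : IsAsymptoticallyPoisson P l T C H) {n : ℕ} (hn : 1 ≤ n)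
    {η x : ℝ} (hη : 0 < η) (hx : η ≤ x) (K : ℕ) {ε : ℝ} (hε : 0 < ε) :
    ∀ᶠ d in l, 1 - Real.exp (-(x - η)) - 2 ^ n * Real.exp (-(K * η / 2)) - ε ≤
      P.real {ω | T d (n + 1) ω - T d n ω ≤ x} := by
  have ε3 : 0 < ε / 3 := by positivity
  have hy : 0 ≤ x - η := by linarith
  filter_upwards [h.add, h.time_le_iff, h.time_nonneg, h.lt_le n (K * η) (cell_nonneg hη K) (ε / 3) ε3,
    (h.tendsto_sum_real_gapEvent hn hη hy K).eventually_lt_const ε3,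
    (h.tendsto_real_gridMismatch hη hy K).eventually_lt_const ε3]
    with d hadd htime hnonneg hlt hsum hmis
  set W := ⋃ k ∈ Finset.range K, gapEvent H d n η (x - η) k
  set B := gridMismatch C H d η (x - η) K
  set Q := {ω | H d 0 (K * η) ω < n}
  set N := {ω | ¬ ∀ n t, 0 ≤ t → (T d n ω ≤ t ↔ (n : ℕ∞) ≤ C d t ω)}
  set Z := {ω | T d (n + 1) ω - T d n ω ≤ x}
  have hN : P.real N = 0 := (measureReal_eq_zero_iff (measure_ne_top _ _)).2 htime
  -- If the gap exceeds x and the n-th point is after kη, the next one comes after kη + x = (k+1)η +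
  -- (x - η). The shorter window x - η absorbs the unknown position inside the cell.
  have hsub : univ ⊆ Z ∪ W ∪ B ∪ Q ∪ N := by
    intro ω _
    by_contra hcon
    simp only [mem_union, not_or] at hcon
    obtain ⟨⟨⟨⟨hZ, hW⟩, hB⟩, hQ⟩, hNω⟩ := hcon
    have htime := not_not.1 hNω
    have hex : ∃ k : ℕ, ¬ H d 0 (k * η) ω < n := ⟨K, hQ⟩
    classical
    -- The first grid time with at least n points is the right end of the cell of the n-th point.
    set m := Nat.find hex with hm
    have hm1 : ¬ H d 0 (m * η) ω < n := Nat.find_spec hex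
    have hmK : m ≤ K := Nat.find_min' hex hQ
    have hm0 : m ≠ 0 := by
      intro h0
      rw [h0, Nat.cast_zero, zero_mul, h.self] at hm1
      exact hm1 (by exact_mod_cast hn)
    obtain ⟨k, hk⟩ := Nat.exists_eq_succ_of_ne_zero hm0
    have hk1 : H d 0 (k * η) ω < n := not_not.1 (Nat.find_min hex (show k < m by omega))
    rw [hk] at hm1
    have hkK : k < K := by omega
    refine hW (mem_biUnion (Finset.mem_coe.2 (Finset.mem_range.2 hkK)) ⟨hk1, hm1, ?_⟩)
    have e0 := (eq_of_notMem_gridMismatch hB (k := k) hkK.le).1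
    have e1 := eq_of_notMem_gridMismatch hB (k := k + 1) hkK
    have hc := cell_nonneg hη k
    have hc1 := cell_nonneg hη (k + 1)
    have hstep : ((k + 1 : ℕ) : ℝ) * η = k * η + η := by push_cast; ring
    have t1 : ¬ T d n ω ≤ k * η := fun hcon => by
      have := (htime n _ hc).1 hcon
      rw [e0] at this
      exact absurd hk1 (not_lt.2 this)
    have hZ' : ¬ T d (n + 1) ω - T d n ω ≤ x := hZ
    have t2 : ¬ T d (n + 1) ω ≤ (k + 1 : ℕ) * η + (x - η) := by
      intro hcon; apply hZ'; linarith
    have hlt : H d 0 ((k + 1 : ℕ) * η + (x - η)) ω < (n + 1 : ℕ) := by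
      rw [← e1.2]
      exact not_le.1 fun hcon => t2 ((htime (n + 1) _ (by linarith)).2 hcon)
    rw [← hadd 0 ((k + 1 : ℕ) * η) _ ω hc1 (by linarith)] at hlt
    have hge : (n : ℕ∞) ≤ H d 0 ((k + 1 : ℕ) * η) ω := not_lt.1 hm1
    by_contra hne
    refine absurd hlt (not_lt.2 ?_)
    rw [Nat.cast_succ]
    exact add_le_add hge (Order.one_le_iff_ne_zero.2 hne)
  have hW : P.real W = ∑ k ∈ Finset.range K, P.real (gapEvent H d n η (x - η) k) :=
    h.real_iUnion_gapEvent hadd n hη _ K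
  have u0 := measureReal_mono (μ := P) hsub
  rw [probReal_univ] at u0
  have u1 := measureReal_union_le (μ := P) (Z ∪ W ∪ B ∪ Q) N
  have u2 := measureReal_union_le (μ := P) (Z ∪ W ∪ B) Q
  have u3 := measureReal_union_le (μ := P) (Z ∪ W) B
  have u4 := measureReal_union_le (μ := P) Z W
  have hq : 0 ≤ P.real Q := measureReal_nonneg
  have hex := Real.exp_pos (-(x - η))
  nlinarith [mul_nonneg hex.le hq]

/-- The gaps are asymptotically exponential. -/
theorem tendsto_real_gap_le (h : IsAsymptoticallyPoisson P l T C H) {n : ℕ} (hn : 1 ≤ n) (x : ℝ) :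
    Tendsto (fun d => P.real {ω | T d (n + 1) ω - T d n ω ≤ x}) l
      (𝓝 ((expMeasure 1).real (Iic x))) := by
  have := isProbabilityMeasure_expMeasure (r := 1) one_pos
  rw [← cdf_eq_real, cdf_expMeasure_eq one_pos, one_mul]
  split_ifs with hx
  · obtain ⟨D, hD0, hD⟩ := h.two_le
    have herr : Tendsto (fun m : ℕ => 2 ^ n * Real.exp (-((m : ℝ) / 2)) + D * (1 / (m : ℝ)) +
        (Real.exp (1 / (m : ℝ) * (1 / (m : ℝ))) - 1)) atTop
        (𝓝 (2 ^ n * 0 + D * 0 + (Real.exp (0 * 0) - 1))) := by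
      have h1 : Tendsto (fun m : ℕ => (1 : ℝ) / m) atTop (𝓝 0) := tendsto_one_div_atTop_nhds_zero_nat
      have h2 : Tendsto (fun m : ℕ => Real.exp (-((m : ℝ) / 2))) atTop (𝓝 0) :=
        Real.tendsto_exp_neg_atTop_nhds_zero.comp
          (tendsto_natCast_atTop_atTop.atTop_div_const two_pos)
      exact ((h2.const_mul _).add (h1.const_mul _)).add
        (((Real.continuous_exp.tendsto _).comp (h1.mul h1)).sub_const 1)
    simp only [mul_zero, Real.exp_zero, sub_self, add_zero] at herr
    have hsmall : ∀ x > 0, ∀ᶠ m : ℕ in atTop, 1 / (m : ℝ) * (1 / (m : ℝ)) ≤ x := by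
      intro x hx
      have h1 : Tendsto (fun m : ℕ => (1 : ℝ) / m) atTop (𝓝 0) := tendsto_one_div_atTop_nhds_zero_nat
      have h2 := h1.mul h1
      rw [mul_zero] at h2
      exact (h2.eventually_lt_const hx).mono fun _ => le_of_lt
    have hparam : ∀ ε > 0, ∃ (η : ℝ) (K : ℕ), 0 < η ∧ (0 < x → η ≤ x) ∧
        2 ^ n * Real.exp (-(K * η / 2)) + K * (D * η ^ 2) + (Real.exp η - 1) < ε := by
      intro ε hε
      have hx' : ∀ᶠ m : ℕ in atTop, 0 < x → 1 / (m : ℝ) * (1 / (m : ℝ)) ≤ x := by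
        rcases hx.lt_or_eq with h0 | h0
        · exact (hsmall x h0).mono fun _ h _ => h
        · exact Eventually.of_forall fun _ h1 => absurd h1 (by simp [← h0])
      obtain ⟨m, hm1, hm2, hm3⟩ :=
        ((herr.eventually_lt_const hε).and (hx'.and (eventually_gt_atTop 0))).exists
      have hmpos : (0 : ℝ) < m := by exact_mod_cast hm3
      -- With η = 1/m² and K = m³ the horizon Kη = m tends to infinity, while the double-point error
      -- Kη² = 1/m tends to 0.
      refine ⟨1 / (m : ℝ) * (1 / (m : ℝ)), m ^ 3, by positivity, hm2, ?_⟩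
      have e1 : ((m ^ 3 : ℕ) : ℝ) * (1 / (m : ℝ) * (1 / (m : ℝ))) = m := by
        push_cast; field_simp
      have e2 : ((m ^ 3 : ℕ) : ℝ) * (D * (1 / (m : ℝ) * (1 / (m : ℝ))) ^ 2) = D * (1 / m) := by
        push_cast; field_simp
      rw [e1, e2]
      exact hm1
    rw [tendsto_order]
    constructor
    · intro c hc
      rcases hx.lt_or_eq with hx0 | hx0
      · set ε := (1 - Real.exp (-x) - c) / 2 with hεdef
        have hε : 0 < ε := by rw [hεdef]; linarith
        obtain ⟨η, K, hη, hηx, herr⟩ := hparam ε hε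
        filter_upwards [h.eventually_le_real_gap hn hη (hηx hx0) K hε] with d hd
        refine lt_of_lt_of_le ?_ hd
        have h1 : Real.exp (-(x - η)) = Real.exp (-x) * Real.exp η := by
          rw [← Real.exp_add]; ring_nf
        have h2 : Real.exp (-x) ≤ 1 := Real.exp_le_one_iff.2 (by linarith)
        have h3 : 1 ≤ Real.exp η := Real.one_le_exp hη.le
        have h4 : Real.exp (-(x - η)) ≤ Real.exp (-x) + (Real.exp η - 1) := by
          rw [h1]; nlinarith
        have h5 : 0 ≤ (K : ℝ) * (D * η ^ 2) := by positivity
        linarith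
      -- At x = 0 the limit is 0, and no window x - η is available; nonnegativity suffices.
      · refine Eventually.of_forall fun d => lt_of_lt_of_le ?_ measureReal_nonneg
        rw [← hx0] at hc
        simpa using hc
    · intro c hc
      set ε := (c - (1 - Real.exp (-x))) / 2 with hεdef
      have hε : 0 < ε := by rw [hεdef]; linarith
      obtain ⟨η, K, hη, -, herr⟩ := hparam ε hε
      filter_upwards [h.eventually_real_gap_le hn hD hη hx K hε] with d hd
      refine lt_of_le_of_lt hd ?_
      have h3 : 1 ≤ Real.exp η := Real.one_le_exp hη.le
      linarith
  -- For x < 0 the event is null because the times are almost surely nondecreasing in n.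
  · refine tendsto_const_nhds.congr' ?_
    filter_upwards [h.time_le_iff, h.time_nonneg] with d htime hnonneg
    refine ((measureReal_eq_zero_iff (measure_ne_top _ _)).2 ?_).symm
    rw [measure_eq_zero_iff_ae_notMem]
    filter_upwards [htime] with ω hω hcon
    have h1 : T d n ω ≤ T d (n + 1) ω := by
      rw [hω n _ (hnonneg _ _)]
      exact le_trans (by exact_mod_cast n.le_succ) ((hω (n + 1) _ (hnonneg _ _)).1 le_rfl)
    have h2 : T d (n + 1) ω - T d n ω ≤ x := hcon
    linarith

end IsAsymptoticallyPoisson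

/-! ### High-level scaling and the conclusion -/

namespace NetworkParams

variable {M : NetworkParams}

theorem tendsto_exp_div_sub_one (hM : M.Admissible) :
    Tendsto (fun δ => Real.exp (δ / M.a) - 1) atTop atTop :=
  tendsto_atTop_add_const_right _ (-1)
    (Real.tendsto_exp_atTop.comp (tendsto_id.atTop_div_const hM.a_pos))

theorem tendsto_rateRadius (hM : M.Admissible) : Tendsto M.rateRadius atTop (𝓝 0) := by
  have hβ : 0 < 1 / M.beta := by have := hM.two_lt_beta; positivity
  have h1 : Tendsto (fun δ => M.p / (M.w * (Real.exp (δ / M.a) - 1))) atTop (𝓝 0) :=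
    tendsto_const_nhds.div_atTop ((tendsto_exp_div_sub_one hM).const_mul_atTop hM.w_pos)
  have h2 := h1.rpow_const (p := 1 / M.beta) (Or.inr hβ.le)
  rwa [Real.zero_rpow hβ.ne'] at h2

/-- From e^{2s} - 1 = (e^s - 1)(e^s + 1), the ratio equals (exp(δ/a) + 1)^(-1/β). This decay is what
makes nodes that have users negligible. -/
theorem tendsto_rateRadius_two_mul_div (hM : M.Admissible) :
    Tendsto (fun δ => M.rateRadius (2 * δ) / M.rateRadius δ) atTop (𝓝 0) := by
  have hβ : 0 < 1 / M.beta := by have := hM.two_lt_beta; positivity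
  have h1 : Tendsto (fun δ => 1 / (Real.exp (δ / M.a) + 1)) atTop (𝓝 0) :=
    tendsto_const_nhds.div_atTop (tendsto_atTop_add_const_right _ 1
      (Real.tendsto_exp_atTop.comp (tendsto_id.atTop_div_const hM.a_pos)))
  have h2 := h1.rpow_const (p := 1 / M.beta) (Or.inr hβ.le)
  rw [Real.zero_rpow hβ.ne'] at h2
  refine h2.congr' ?_
  filter_upwards [eventually_gt_atTop 0] with δ hδ
  have hp := hM.p_pos
  have hw := hM.w_pos
  have h0 : 0 < δ / M.a := div_pos hδ hM.a_pos
  have hE : 0 < Real.exp (δ / M.a) - 1 := by linarith [Real.add_one_le_exp (δ / M.a)]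
  have hE2 : Real.exp (2 * δ / M.a) = Real.exp (δ / M.a) ^ 2 := by
    rw [← Real.exp_nat_mul]; congr 1; push_cast; ring
  have hfac : Real.exp (2 * δ / M.a) - 1 = (Real.exp (δ / M.a) - 1) * (Real.exp (δ / M.a) + 1) := by
    rw [hE2]; ring
  have hE3 : 0 < Real.exp (2 * δ / M.a) - 1 := by rw [hfac]; positivity
  rw [rateRadius, rateRadius, coverageRadius, coverageRadius,
    ← Real.div_rpow (by positivity) (by positivity)]
  congr 1
  rw [hfac]
  field_simp

/-- The conversion of rescaled time into travelled distance at the rate level `δ`. -/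
noncomputable def scaledDist (M : NetworkParams) (δ τ : ℝ) : ℝ :=
  τ / (2 * M.lam * M.rateRadius δ * Real.exp (-(M.xi * Real.pi * M.coverageRadius M.gam ^ 2)))

theorem scaledDist_mono (hM : M.Admissible) {δ s t : ℝ} (hδ : 0 < δ) (h : s ≤ t) :
    M.scaledDist δ s ≤ M.scaledDist δ t := by
  have := hM.lam_pos
  have := rateRadius_pos hM hδ
  unfold scaledDist
  gcongr

/-- The tube between two rescaled times has an area independent of δ, chosen so that its mean number
of free nodes is t - s. -/
theorem scaledDist_sub_mul (hM : M.Admissible) {δ : ℝ} (hδ : 0 < δ) (s t : ℝ) :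
    (M.scaledDist δ t - M.scaledDist δ s) * (2 * M.rateRadius δ) =
      (t - s) / (M.lam * Real.exp (-(M.xi * Real.pi * M.coverageRadius M.gam ^ 2))) := by
  have h1 := (hM.lam_pos).ne'
  have h2 := (rateRadius_pos hM hδ).ne'
  have h3 := (Real.exp_pos (-(M.xi * Real.pi * M.coverageRadius M.gam ^ 2))).ne'
  unfold scaledDist
  field_simp

end NetworkParams

namespace IsPoissonPointProcess

open NetworkParams

variable {Ω : Type*} [MeasurableSpace Ω] {P : Measure Ω} [IsProbabilityMeasure P]
  {X U : ℕ → Ω → Plane} {M : NetworkParams} {b : OrthonormalBasis (Fin 2) ℝ Plane}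

/-- The length is A/ρ, so the narrow strip costs the order of the ratio of the two radii plus their
product, the end boxes cost ρ², and close pairs cost (ℓ/ρ + 1)ρ⁴, again of order ρ². -/
theorem tendsto_real_not_isSparse (hM : M.Admissible) (hX : IsPoissonPointProcess P X M.lam)
    (b : OrthonormalBasis (Fin 2) ℝ Plane) {τ : ℝ} (hτ : 0 ≤ τ) :
    Tendsto (fun δ => P.real {ω | ¬ IsSparse b (fun i => X i ω) (M.rateRadius δ)
      (M.rateRadius (2 * δ)) (M.scaledDist δ τ)}) atTop (𝓝 0) := by
  set A := τ / (2 * M.lam * Real.exp (-(M.xi * Real.pi * M.coverageRadius M.gam ^ 2))) with hA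
  have hl := hM.lam_pos
  have hρ := tendsto_rateRadius hM
  have hρ2 : Tendsto (fun δ => M.rateRadius (2 * δ)) atTop (𝓝 0) :=
    hρ.comp (tendsto_id.const_mul_atTop two_pos)
  have hq := tendsto_rateRadius_two_mul_div hM
  have hlim := ((((hq.const_mul (2 * M.lam * A)).add ((hρ.mul hρ2).const_mul (6 * M.lam))).add
    ((hρ.pow 2).const_mul (12 * M.lam))).add ((hρ.pow 2).const_mul (900 * M.lam ^ 2 * A))).add
    ((hρ.pow 4).const_mul (900 * M.lam ^ 2))
  norm_num at hlim
  refine squeeze_zero' (Eventually.of_forall fun _ => measureReal_nonneg) ?_ hlim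
  filter_upwards [eventually_gt_atTop 0] with δ hδ
  have hρ0 := rateRadius_pos hM hδ
  have hρ20 : 0 < M.rateRadius (2 * δ) := rateRadius_pos hM (by linarith)
  have hs : M.scaledDist δ τ = A / M.rateRadius δ := by
    rw [hA, scaledDist, div_div]; congr 1; ring
  have hA0 : 0 ≤ A := by positivity
  rw [hs]
  refine (hX.real_not_isSparse_le hl b hρ0 hρ20.le (by positivity)).trans (le_of_eq ?_)
  field_simp
  ring

theorem integral_abs_volume_freeRegion_scaled_le (hM : M.Admissible)
    (hU : IsPoissonPointProcess P U M.xi) (b : OrthonormalBasis (Fin 2) ℝ Plane) {δ s t : ℝ}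
    (hδ : 0 < δ) (hst : s ≤ t) :
    ∫ ω, |M.lam * volume.real (freeRegion (M.coverageRadius M.gam) (fun j => U j ω) ∩
        pathTube b (M.scaledDist δ s) (M.scaledDist δ t) (M.rateRadius δ)) - (t - s)| ∂P ≤
      M.lam * √(8 * M.coverageRadius M.gam * M.rateRadius δ * ((t - s) /
        (M.lam * Real.exp (-(M.xi * Real.pi * M.coverageRadius M.gam ^ 2))))) := by
  have h := hU.integral_abs_volume_freeRegion_pathTube_sub_le hM.xi_pos (coverageRadius_pos hM).le
    hM.lam_pos b (scaledDist_mono hM hδ hst) (rateRadius_pos hM hδ).le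
  rw [scaledDist_sub_mul hM hδ, mul_div_cancel₀ _ (mul_pos hM.lam_pos (Real.exp_pos _)).ne'] at h
  exact h

theorem tendsto_scaled_error (hM : M.Admissible) (c : ℝ) :
    Tendsto (fun δ => M.lam * √(8 * M.coverageRadius M.gam * M.rateRadius δ * c)) atTop (𝓝 0) := by
  have h : Continuous fun ρ : ℝ => M.lam * √(8 * M.coverageRadius M.gam * ρ * c) := by fun_prop
  simpa [Function.comp_def] using (h.tendsto 0).comp (tendsto_rateRadius hM)

/-- The rescaled up-crossings of a high level are asymptotically a Poisson process of rate one. -/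
theorem isAsymptoticallyPoisson_upCrossings (hM : M.Admissible)
    (hX : IsPoissonPointProcess P X M.lam) (hU : IsPoissonPointProcess P U M.xi)
    (hXU : IndepFun (fun ω i => X i ω) (fun ω j => U j ω) P)
    (hb : b 0 = M.dir) :
    IsAsymptoticallyPoisson P atTop
      (fun δ n ω => 2 * M.lam * M.v * M.rateRadius δ *
        Real.exp (-(M.xi * Real.pi * M.coverageRadius M.gam ^ 2)) *
        nthUpCrossing (M.lowerSharedRate (fun i => X i ω) (fun j => U j ω)) δ n)
      (fun δ τ ω => (upCrossingSet (M.lowerSharedRate (fun i => X i ω) (fun j => U j ω)) δ ∩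
        Iic (M.scaledDist δ τ / M.v)).encard)
      (fun δ s t ω => freeCount (M.coverageRadius M.gam) (fun i => X i ω) (fun j => U j ω)
        (pathTube b (M.scaledDist δ s) (M.scaledDist δ t) (M.rateRadius δ))) where
  measurable δ s t := measurable_freeCount_process hX hU _ (measurableSet_pathTube b _ _ _)
  self δ s ω := by
    refine (pointCount_eq_zero_iff _ _).2 fun i hi => ?_
    exact absurd hi.2.1.1 (not_lt.2 hi.2.1.2)
  add := by
    filter_upwards [eventually_gt_atTop 0] with δ hδ s t u ω hst htu
    rw [← freeCount_union _ _ _ (disjoint_pathTube b le_rfl _),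
      pathTube_union b (scaledDist_mono hM hδ hst) (scaledDist_mono hM hδ htu)]
  count_eq τ hτ := by
    refine squeeze_zero' (Eventually.of_forall fun _ => measureReal_nonneg) ?_
      (tendsto_real_not_isSparse hM hX b hτ)
    filter_upwards [eventually_gt_atTop 0,
      (tendsto_rateRadius hM).eventually_le_const (coverageRadius_pos hM)] with δ hδ hδr
    -- Up to the null set of configurations that are not locally finite, the two counts can differ
    -- only when sparseness fails.
    refine ENNReal.toReal_mono (measure_ne_top _ _) (measure_mono_ae ?_)
    filter_upwards [hX.ae_finite_closedBall hM.lam_pos, hU.ae_finite_closedBall hM.xi_pos]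
      with ω hx hu hne hs
    refine hne ?_
    have h := encard_upCrossingSet_inter_Iic hM hb hx hu hδ hδr hs
    have h0 : M.scaledDist δ 0 = 0 := by simp [scaledDist]
    simp only [h0]
    exact h
  time_le_iff := by
    filter_upwards [eventually_gt_atTop 0] with δ hδ
    filter_upwards [ae_upCrossingSet hM hX hU hXU hδ] with ω hω n t ht
    have hc : 0 < 2 * M.lam * M.v * M.rateRadius δ *
        Real.exp (-(M.xi * Real.pi * M.coverageRadius M.gam ^ 2)) := by
      have := hM.lam_pos
      have := hM.v_pos
      have := rateRadius_pos hM hδ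
      positivity
    have hs : M.scaledDist δ t / M.v = t / (2 * M.lam * M.v * M.rateRadius δ *
        Real.exp (-(M.xi * Real.pi * M.coverageRadius M.gam ^ 2))) := by
      rw [scaledDist, div_div]; congr 1; ring
    rw [hs, ← nthUpCrossing_le_iff hω.1 hω.2 (by positivity), le_div_iff₀' hc]
  time_nonneg := by
    filter_upwards [eventually_gt_atTop 0] with δ hδ n ω
    have := hM.lam_pos
    have := hM.v_pos
    have := rateRadius_pos hM hδ
    have : 0 ≤ nthUpCrossing (M.lowerSharedRate (fun i => X i ω) (fun j => U j ω)) δ n :=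
      Real.sInf_nonneg fun _ ht => ht.1
    positivity
  void n s t u hs hst htu := by
    refine squeeze_zero_norm' ?_ (tendsto_scaled_error hM ((u - t) /
      (M.lam * Real.exp (-(M.xi * Real.pi * M.coverageRadius M.gam ^ 2)))))
    filter_upwards [eventually_gt_atTop 0] with δ hδ
    exact (abs_real_freeCount_lt_inter_sub_le hX hM.lam_pos hU.measurable_point hXU _
      (measurableSet_pathTube b _ _ _) (measurableSet_pathTube b _ _ _)
      (volume_pathTube_ne_top b _ _ _) (disjoint_pathTube b (scaledDist_mono hM hδ hst) _) n
      (by linarith)).trans (hU.integral_abs_volume_freeRegion_scaled_le hM b hδ htu)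
  lt_le n t ht ε hε := by
    have hlim := (tendsto_scaled_error hM ((t - 0) /
      (M.lam * Real.exp (-(M.xi * Real.pi * M.coverageRadius M.gam ^ 2))))).const_mul (2 ^ n)
    rw [mul_zero] at hlim
    filter_upwards [eventually_gt_atTop 0, hlim.eventually_lt_const hε] with δ hδ hδε
    have h1 := real_freeCount_lt_le hX hM.lam_pos hU.measurable_point hXU (M.coverageRadius M.gam)
      (measurableSet_pathTube b (M.scaledDist δ 0) (M.scaledDist δ t) (M.rateRadius δ))
      (volume_pathTube_ne_top b _ _ _) n (μ := t - 0) (by linarith)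
    have h2 := mul_le_mul_of_nonneg_left (hU.integral_abs_volume_freeRegion_scaled_le hM b hδ ht)
      (show (0 : ℝ) ≤ 2 ^ n by positivity)
    rw [mul_add] at h1
    rw [sub_zero] at h1 h2 hδε
    linarith
  two_le := by
    -- Free nodes are bounded by all nodes of the tube, whose mean number is (t - s)/κ.
    refine ⟨(1 / Real.exp (-(M.xi * Real.pi * M.coverageRadius M.gam ^ 2))) ^ 2, by positivity, ?_⟩
    filter_upwards [eventually_gt_atTop 0] with δ hδ s t hs hst
    refine (measureReal_mono fun ω hω => le_trans hω (freeCount_le_pointCount _ _ _ _)).trans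
      ((hX.real_two_le_count_le hM.lam_pos (measurableSet_pathTube b _ _ _)
        (volume_pathTube_ne_top b _ _ _)).trans (le_of_eq ?_))
    rw [volume_real_pathTube b (scaledDist_mono hM hδ hst) (rateRadius_pos hM hδ).le,
      scaledDist_sub_mul hM hδ]
    have := hM.lam_pos.ne'
    field_simp

end IsPoissonPointProcess

theorem mainTheorem10 {Ω : Type*} [MeasurableSpace Ω] (P : Measure Ω) [IsProbabilityMeasure P]
    (M : NetworkParams) (hM : M.Admissible)
    (X U : ℕ → Ω → Plane)
    (hX : IsPoissonPointProcess P X M.lam)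
    (hU : IsPoissonPointProcess P U M.xi)
    (hXU : IndepFun (fun ω i => X i ω) (fun ω j => U j ω) P)
    (S : Ω → ℝ → ℝ)
    (hS : ∀ ω t, S ω t = M.lowerSharedRate (fun i => X i ω) (fun j => U j ω) t) :
    (∀ δ > 0, ∀ᵐ ω ∂P, (upCrossingSet (S ω) δ).Infinite ∧
      ∀ t : ℝ, (upCrossingSet (S ω) δ ∩ Iic t).Finite) ∧
    ∀ n : ℕ, 1 ≤ n → ∀ x : ℝ,
      Tendsto
        (fun δ : ℝ => P.real {ω |
          2 * M.lam * M.v * M.rateRadius δ *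
              Real.exp (-(M.xi * Real.pi * M.coverageRadius M.gam ^ 2)) *
            (nthUpCrossing (S ω) δ (n + 1) - nthUpCrossing (S ω) δ n) ≤ x})
        atTop (𝓝 ((expMeasure 1).real (Iic x))) := by
  obtain rfl : S = fun ω => M.lowerSharedRate (fun i => X i ω) (fun j => U j ω) :=
    funext fun ω => funext (hS ω)
  obtain ⟨b, hb⟩ := exists_orthonormalBasis_zero_eq hM.norm_dir
  refine ⟨fun δ hδ => IsPoissonPointProcess.ae_upCrossingSet hM hX hU hXU hδ, fun n hn x => ?_⟩
  have h := (IsPoissonPointProcess.isAsymptoticallyPoisson_upCrossings hM hX hU hXU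
    hb).tendsto_real_gap_le hn x
  simp only [← mul_sub] at h
  exact h
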